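/- Fix a set $T$ of events and $c\in\mathbb N$. **Slices.** A unit slice $\mathbf S$ consists of a center vertex $v$ labeled by an element of $T$, an in-frontier $I$ and an out-frontier $O$, each numbered by consecutive integers, and a DAG structure on $I\,\dot\cup\,\{v\}\,\dot\cup\,O$ such that every frontier vertex is touched by exactly one edge, outgoing for vertices in $I$ and incoming for vertices in $O$. Its width is $\max(|I|,|O|)$. It is initial if $I=\emptyset$, final if $O=\emptyset$, and non-degenerate if $v$ is joined to $I$ whenever $I\ne\emptyset$ and to $O$ whenever $O\neq\emptyset$. Two slices $\mathbf S,\mathbf S'$ can be composed if $|O|=|I'|$; one then glues the edge touching the $j$-th out-frontier vertex of $\mathbf S$ to the edge touching the $j$-th in-frontier vertex of $\mathbf S'$. $\Sigma_{\mathbb S}^c$ is the set of non-degenerate unit slices of width at most $c$ with center labeled in $T$. If $\mathbf S_1$ is initial, $\mathbf S_n$ final and consecutive slices can be composed, the word $\mathbf S_1\cdots\mathbf S_n$ is a unit decomposition of the DAG $H=\mathbf S_1\circ\cdots\circ\mathbf S_n$ (which may have multiple edges), whose vertices are the $n$ centers. **Slice graphs.** A slice graph $\mathcal{SG}$ is a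 finite directed graph (loops allowed, no multiple edges) with a label $\mathcal S(a)$, a unit slice, on each vertex $a$, such that $\mathcal S(a)$ can be composed with $\mathcal S(a')$ for every edge $(a,a')$; it is over $\Sigma_{\mathbb S}^c$ if all labels are in $\Sigma_{\mathbb S}^c$. A vertex is initial (final) if its label is. The slice language $\mathcal L$ of $\mathcal{SG}$ is the set of label words of walks from an initial to a final vertex, and $\mathcal L_G$ is the set of DAGs composed from the words of $\mathcal L$. $\mathcal{SG}$ is weakly saturated if for every $H\in\mathcal L_G$ and every topological ordering $v_1\cdots v_n$ of $H$, $\mathcal L$ contains a unit decomposition $\mathbf S_1\cdots\mathbf S_n$ of $H$ in which $v_i$ is the center of $\mathbf S_i$ for every $i$. **Colorings.** Write $e^s,e^t$ for the source and target of an edge $e$. A transitivity coloring of $\mathbf S$ with edge set $E$ is a partial function $\theta:E^2\to\{0,1\}^2$ such that (i) $\theta(e_1e_2)$ is undefined iff $e_1^s=e_2^t$ or $e_1^t=e_2^s$; (ii) $\theta(e_1e_2)=ab$ implies $\theta(e_2e_1)=ba$; (iii) $\theta(ee)\in\{00,11\}$, and $e$ is called unmarked if $\theta(ee)=00$ and marked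 if $\theta(ee)=11$; (iv) if $e_1\ne e_2$ have the same source then $\theta(e_1e_2)=00$; (v) if $e_1^s\in I$, $e_1^t\in O$ and $e_2^s=v$, then $\theta(e_1e_2)\in\{01,11\}$, and $\theta(e_1e_2)=01$ iff $\theta(e_1e)\in\{00,01\}$ for some $e$ with $e^t=v$; (vi) if $e^t=v$, then $e$ is marked iff $\theta(ee_1)=01$ for some $e_1$ with $e_1^t=v$. A multi-edge transitivity coloring is a triple $(\theta,\mathcal P^{in},\mathcal P^{out})$ of a transitivity coloring and partitions of $I$ and of $O$ into consecutively numbered non-empty cells such that (a) if two edges touch the same cell of one of the partitions, then both are connected to $v$ or both touch the same cell of the other partition; (b) $\theta(ee_1)=\theta(ee_2)$ (as partial values) for all pairwise distinct $e,e_1,e_2$ such that $e_1,e_2$ touch the same cell of $\mathcal P^{in}$ or of $\mathcal P^{out}$; (c) edges touching the same cell are all marked or all unmarked; (d) if $e_1^t=e_2^t=v$ and $\theta(e_1e_2)=00$, then $e_1,e_2$ touch the same cell of $\mathcal P^{in}$. **Transitive reduction.** The graph $\mathcal{HG}$ is obtained from $\mathcal{SG}$ as follows. (1) Replace each vertex $a$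 by vertices $a_{\theta,\mathcal P}$, one for each multi-edge transitivity coloring of $\mathcal S(a)$, all labeled $\mathcal S(a)$, with an edge from $a_{\theta,\mathcal P}$ to $a'_{\theta',\mathcal P'}$ iff $(a,a')$ is an edge of $\mathcal{SG}$ and both the values of $\theta$ (on all pairs of edges, including pairs $ee$) and the cell numbers on the out-frontier of $\mathcal S(a)$ agree with those of $\theta',\mathcal P'$ on the in-frontier of $\mathcal S(a')$. (2) Delete the vertices that cannot be reached from an initial vertex or cannot reach a final vertex. (3) Relabel each remaining $a_{\theta,\mathcal P}$ by the slice obtained from $\mathcal S(a)$ by collapsing each cell to a single frontier vertex, collapsing all edges touching the same cell to one edge, and deleting the marked edges together with the frontier vertices they touch, the remaining frontier vertices being renumbered consecutively in the order of their cell numbers. **Proposition.** If $\mathcal{SG}$ is a weakly saturated slice graph over $\Sigma_{\mathbb S}^c$, then the slice graph $\mathcal{HG}$ obtained from it by this transitive reduction is weakly saturated. -/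

import Mathlib

universe u v

/-- Vertices of a unit slice: the in-frontier and out-frontier vertices, numbered (from `0`),
and the unique center vertex. -/
inductive SliceVertex (m n : ℕ) : Type
  | inF (i : Fin m) : SliceVertex m n
  | center : SliceVertex m n
  | outF (j : Fin n) : SliceVertex m n

/-- A unit slice over the set of events `T`. Every frontier vertex is touched by exactly one edge,
which leaves it (in-frontier) or enters it (out-frontier). Acyclicity amounts to the absence of a
loop at the center, and multiple edges are impossible since every edge touches a frontier. -/
structure UnitSlice (T : Type u) where
  /-- size of the in-frontier -/
  inn : ℕ
  /-- size of the out-frontier -/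
  out : ℕ
  /-- label of the center vertex -/
  event : T
  Adj : SliceVertex inn out → SliceVertex inn out → Prop
  not_adj_in : ∀ x i, ¬ Adj x (.inF i)
  not_out_adj : ∀ j x, ¬ Adj (.outF j) x
  not_loop : ¬ Adj .center .center
  in_unique : ∀ i, ∃! x, Adj (.inF i) x
  out_unique : ∀ j, ∃! x, Adj x (.outF j)

namespace UnitSlice

variable {T : Type u}

/-- The edges of a unit slice. -/
def Edge (S : UnitSlice T) : Type :=
  {p : SliceVertex S.inn S.out × SliceVertex S.inn S.out // S.Adj p.1 p.2}

/-- Source of an edge. -/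
def Edge.src {S : UnitSlice T} (e : S.Edge) : SliceVertex S.inn S.out := e.1.1

/-- Target of an edge. -/
def Edge.tgt {S : UnitSlice T} (e : S.Edge) : SliceVertex S.inn S.out := e.1.2

/-- A slice is initial if its in-frontier is empty. -/
def IsInitial (S : UnitSlice T) : Prop := S.inn = 0

/-- A slice is final if its out-frontier is empty. -/
def IsFinal (S : UnitSlice T) : Prop := S.out = 0

/-- `S` can be composed with `S'`. -/
def Composable (S S' : UnitSlice T) : Prop := S.out = S'.inn

/-- The slice width: the size of the greatest frontier. -/
def width (S : UnitSlice T) : ℕ := max S.inn S.out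

/-- Non-degenerate unit slices: the center is connected to each non-empty frontier. -/
def Nondegenerate (S : UnitSlice T) : Prop :=
  (S.inn ≠ 0 → ∃ i, S.Adj (.inF i) .center) ∧ (S.out ≠ 0 → ∃ j, S.Adj .center (.outF j))

end UnitSlice

/-- The slice alphabet of width `c` over the set of events `T`. -/
def sliceAlphabet (T : Type u) (c : ℕ) : Set (UnitSlice T) :=
  {S | S.Nondegenerate ∧ S.width ≤ c}

/-! ### DAGs and unit decompositions -/

/-- Vertex-labeled directed acyclic graphs, with multiple edges allowed. -/
structure DAG (T : Type u) where
  V : Type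
  E : Type
  src : E → V
  tgt : E → V
  label : V → T
  acyclic : ∀ x, ¬ Relation.TransGen (fun a b => ∃ e, src e = a ∧ tgt e = b) x x

/-- The (strict) partial order induced by a DAG. -/
def DAG.Lt {T : Type u} (H : DAG T) : H.V → H.V → Prop :=
  Relation.TransGen (fun a b => ∃ e, H.src e = a ∧ H.tgt e = b)

/-- `o 0, o 1, …, o (n-1)` is a topological ordering of the vertices of `H`. -/
def DAG.IsTopologicalOrdering {T : Type u} (H : DAG T) {n : ℕ} (o : Fin n ≃ H.V) : Prop :=
  ∀ i j, H.Lt (o i) (o j) → i < j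

/-- Slice strings which may belong to a slice language: the first slice is initial, the last one
is final, and consecutive slices can be composed. -/
def IsSliceWord {T : Type u} {n : ℕ} (w : Fin n → UnitSlice T) : Prop :=
  (∀ i : Fin n, i.val = 0 → (w i).IsInitial) ∧
  (∀ i : Fin n, i.val + 1 = n → (w i).IsFinal) ∧
  (∀ i j : Fin n, i.val + 1 = j.val → (w i).Composable (w j))

/-- The edge `x` of a slice of `w` touches the `k`-th out-frontier vertex of its slice, and the
edge `y` of the next slice touches the `k`-th in-frontier vertex: they are glued. -/
def Glued {T : Type u} {n : ℕ} (w : Fin n → UnitSlice T) (x y : Σ i, (w i).Edge) : Prop :=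
  x.1.val + 1 = y.1.val ∧
    ∃ k l, x.2.tgt = .outF k ∧ y.2.src = .inF l ∧ k.val = l.val

/-- `w` is a unit decomposition of `H` in which `c i` is the center vertex of the `i`-th slice:
the composition of `w` is `H`. The edges of the composition are the classes of edges of the slices
under gluing, and `part` sends an edge of a slice to the edge of `H` of which it is a sliced part. -/
def IsUnitDecomposition {T : Type u} {n : ℕ} (w : Fin n → UnitSlice T) (H : DAG T)
    (c : Fin n ≃ H.V) : Prop :=
  IsSliceWord w ∧
  (∀ i, H.label (c i) = (w i).event) ∧
  ∃ part : (Σ i, (w i).Edge) → H.E,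
    Function.Surjective part ∧
    (∀ x y, part x = part y ↔ Relation.EqvGen (Glued w) x y) ∧
    (∀ x, x.2.src = .center → H.src (part x) = c x.1) ∧
    (∀ x, x.2.tgt = .center → H.tgt (part x) = c x.1)

/-- The graph language of a slice language: the DAGs obtained by composing its strings. -/
def graphLanguage {T : Type u} (L : Language (UnitSlice T)) : Set (DAG T) :=
  {H | ∃ (n : ℕ) (w : Fin n → UnitSlice T) (c : Fin n ≃ H.V),
    List.ofFn w ∈ L ∧ IsUnitDecomposition w H c}

/-- Weakly saturated slice languages. -/
def IsWeaklySaturatedLanguage {T : Type u} (L : Language (UnitSlice T)) : Prop :=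
  ∀ H ∈ graphLanguage L, ∀ (n : ℕ) (o : Fin n ≃ H.V), H.IsTopologicalOrdering o →
    ∃ w : Fin n → UnitSlice T, List.ofFn w ∈ L ∧ IsUnitDecomposition w H o

/-! ### Slice graphs -/

/-- Slice graphs: finite directed graphs, possibly with loops but without multiple edges, whose
vertices are labeled with unit slices. -/
structure SliceGraph (T : Type u) where
  V : Type v
  finite_V : Finite V
  E : V → V → Prop
  slice : V → UnitSlice T
  composable : ∀ a b, E a b → (slice a).Composable (slice b)

namespace SliceGraph

variable {T : Type u}

/-- All labels of the slice graph belong to the slice alphabet `A`. -/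
def Over (G : SliceGraph.{u, v} T) (A : Set (UnitSlice T)) : Prop := ∀ a, G.slice a ∈ A

/-- The slice language of a slice graph: labels of the walks from an initial to a final vertex. -/
def language (G : SliceGraph.{u, v} T) : Language (UnitSlice T) :=
  {w | ∃ (n : ℕ) (a : Fin (n + 1) → G.V),
    (∀ i : Fin n, G.E (a i.castSucc) (a i.succ)) ∧
    (G.slice (a 0)).IsInitial ∧ (G.slice (a (Fin.last n))).IsFinal ∧
    w = List.ofFn (fun i => G.slice (a i))}

/-- A slice graph is weakly saturated if its slice language is. -/
def IsWeaklySaturated (G : SliceGraph.{u, v} T) : Prop := IsWeaklySaturatedLanguage G.language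

end SliceGraph

/-! ### Transitivity colorings -/

/-- Transitivity colorings of a unit slice. The color `ab` is the pair `(a, b)` of Booleans
and `none` stands for "undefined". -/
structure IsTransitivityColoring {T : Type u} (S : UnitSlice T)
    (θ : S.Edge → S.Edge → Option (Bool × Bool)) : Prop where
  undefined_iff : ∀ e₁ e₂, θ e₁ e₂ = none ↔ (e₁.src = e₂.tgt ∨ e₁.tgt = e₂.src)
  antisymm : ∀ e₁ e₂ a b, θ e₁ e₂ = some (a, b) → θ e₂ e₁ = some (b, a)
  marking : ∀ e, θ e e = some (false, false) ∨ θ e e = some (true, true)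
  same_source : ∀ e₁ e₂, e₁.src = e₂.src → e₂ ≠ e₁ → θ e₁ e₂ = some (false, false)
  crossing : ∀ e₁ e₂, (∃ i, e₁.src = .inF i) → (∃ j, e₁.tgt = .outF j) → e₂.src = .center →
    (θ e₁ e₂ = some (false, true) ∨ θ e₁ e₂ = some (true, true)) ∧
    (θ e₁ e₂ = some (false, true) ↔
      ∃ e, e.tgt = .center ∧ (θ e₁ e = some (false, false) ∨ θ e₁ e = some (false, true)))
  marked_iff : ∀ e, e.tgt = .center →
    (θ e e = some (true, true) ↔ ∃ e₁, e₁.tgt = .center ∧ θ e e₁ = some (false, true))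

/-- Numbered partitions of an `m`-element set: `cell i` is the number of the cell of `i`, and the
(non-empty) cells are numbered `0, …, k-1`. -/
structure NumberedPartition (m : ℕ) where
  cell : Fin m → ℕ
  numbered : ∃ k, Set.range cell = Set.Iio k

/-- `e₁` and `e₂` touch the same cell of the partition `P` of the in-frontier. -/
def SameInCell {T : Type u} {S : UnitSlice T} (P : NumberedPartition S.inn)
    (e₁ e₂ : S.Edge) : Prop :=
  ∃ i₁ i₂, e₁.src = .inF i₁ ∧ e₂.src = .inF i₂ ∧ P.cell i₁ = P.cell i₂

/-- `e₁` and `e₂` touch the same cell of the partition `P` of the out-frontier. -/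
def SameOutCell {T : Type u} {S : UnitSlice T} (P : NumberedPartition S.out)
    (e₁ e₂ : S.Edge) : Prop :=
  ∃ j₁ j₂, e₁.tgt = .outF j₁ ∧ e₂.tgt = .outF j₂ ∧ P.cell j₁ = P.cell j₂

/-- Multi-edge transitivity colorings of a unit slice. -/
structure MultiEdgeColoring {T : Type u} (S : UnitSlice T) where
  θ : S.Edge → S.Edge → Option (Bool × Bool)
  Pin : NumberedPartition S.inn
  Pout : NumberedPartition S.out
  coloring : IsTransitivityColoring S θ
  in_cell : ∀ e₁ e₂, SameInCell Pin e₁ e₂ →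
    (e₁.tgt = .center ∧ e₂.tgt = .center) ∨ SameOutCell Pout e₁ e₂
  out_cell : ∀ e₁ e₂, SameOutCell Pout e₁ e₂ →
    (e₁.src = .center ∧ e₂.src = .center) ∨ SameInCell Pin e₁ e₂
  same_color : ∀ e e₁ e₂, e₁ ≠ e₂ → e ≠ e₁ → e ≠ e₂ →
    (SameInCell Pin e₁ e₂ ∨ SameOutCell Pout e₁ e₂) → θ e e₁ = θ e e₂
  same_marking : ∀ e₁ e₂, (SameInCell Pin e₁ e₂ ∨ SameOutCell Pout e₁ e₂) →
    (θ e₁ e₁ = some (true, true) ↔ θ e₂ e₂ = some (true, true))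
  same_target : ∀ e₁ e₂, e₁.tgt = .center → e₂.tgt = .center →
    θ e₁ e₂ = some (false, false) → SameInCell Pin e₁ e₂

theorem NumberedPartition.cell_lt {m : ℕ} (P : NumberedPartition m) (i : Fin m) :
    P.cell i < m := by
  obtain ⟨k, hk⟩ := P.numbered
  have h1 : P.cell i < k := by
    have : P.cell i ∈ Set.range P.cell := ⟨i, rfl⟩
    rw [hk] at this
    exact this
  have h2 : (Finset.univ.image P.cell) = Finset.range k := by
    apply Finset.coe_injective
    rw [Finset.coe_image, Finset.coe_univ, Set.image_univ, hk, Finset.coe_range]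
  have h3 : (Finset.univ.image P.cell).card ≤ m := by
    simpa using (Finset.card_image_le (s := (Finset.univ : Finset (Fin m))) (f := P.cell))
  rw [h2, Finset.card_range] at h3
  omega

instance {m n : ℕ} : Finite (SliceVertex m n) := by
  let f : SliceVertex m n → Fin m ⊕ Unit ⊕ Fin n := fun x => match x with
    | .inF i => Sum.inl i
    | .center => Sum.inr (Sum.inl ())
    | .outF j => Sum.inr (Sum.inr j)
  apply Finite.of_injective f
  intro x y h
  cases x <;> cases y <;> simp_all [f]

instance {T : Type u} (S : UnitSlice T) : Finite S.Edge := by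
  unfold UnitSlice.Edge
  infer_instance

instance {m : ℕ} : Finite (NumberedPartition m) := by
  apply Finite.of_injective
    (fun (P : NumberedPartition m) (i : Fin m) => (⟨P.cell i, P.cell_lt i⟩ : Fin m))
  rintro ⟨c, h⟩ ⟨d, h'⟩ hcd
  have : c = d := by
    funext i
    have := congrFun hcd i
    simpa using this
  subst this
  rfl

instance {T : Type u} (S : UnitSlice T) : Finite (MultiEdgeColoring S) := by
  apply Finite.of_injective
    (fun (M : MultiEdgeColoring S) => (M.θ, M.Pin, M.Pout))
  rintro ⟨a, b, c, _, _, _, _, _, _⟩ ⟨a', b', c', _, _, _, _, _, _⟩ h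
  simp only [Prod.mk.injEq] at h
  obtain ⟨rfl, rfl, rfl⟩ := h
  rfl

namespace MultiEdgeColoring

variable {T : Type u} {S : UnitSlice T}

/-- The numbers of the in-frontier cells whose edges are unmarked. -/
noncomputable def unmarkedIn (M : MultiEdgeColoring S) : Finset ℕ :=
  open Classical in
  (Finset.univ.filter fun i => ∃ e : S.Edge, e.src = .inF i ∧
    M.θ e e = some (false, false)).image M.Pin.cell

/-- The numbers of the out-frontier cells whose edges are unmarked. -/
noncomputable def unmarkedOut (M : MultiEdgeColoring S) : Finset ℕ :=
  open Classical in
  (Finset.univ.filter fun j => ∃ e : S.Edge, e.tgt = .outF j ∧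
    M.θ e e = some (false, false)).image M.Pout.cell

/-- `M.Collapses x y`: the vertex `x` of the original slice is collapsed into the vertex `y` of
the reduced slice. The frontier vertices of the reduced slice are the unmarked cells, enumerated in
increasing order of their numbers. -/
def Collapses (M : MultiEdgeColoring S) :
    SliceVertex S.inn S.out → SliceVertex M.unmarkedIn.card M.unmarkedOut.card → Prop
  | .inF i, .inF p => M.Pin.cell i = M.unmarkedIn.orderEmbOfFin rfl p
  | .center, .center => True
  | .outF j, .outF q => M.Pout.cell j = M.unmarkedOut.orderEmbOfFin rfl q
  | _, _ => False

theorem not_marked_iff (M : MultiEdgeColoring S) (e : S.Edge) :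
    M.θ e e = some (false, false) ↔ ¬ M.θ e e = some (true, true) := by
  rcases M.coloring.marking e with h | h <;> simp [h]

theorem unmarked_iff_of_same (M : MultiEdgeColoring S) {e₁ e₂ : S.Edge}
    (h : SameInCell M.Pin e₁ e₂ ∨ SameOutCell M.Pout e₁ e₂) :
    M.θ e₁ e₁ = some (false, false) ↔ M.θ e₂ e₂ = some (false, false) := by
  rw [M.not_marked_iff, M.not_marked_iff, M.same_marking e₁ e₂ h]

theorem exists_in (M : MultiEdgeColoring S) (p : Fin M.unmarkedIn.card) :
    ∃ e : S.Edge, ∃ i, e.src = .inF i ∧ M.θ e e = some (false, false) ∧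
      M.Pin.cell i = M.unmarkedIn.orderEmbOfFin rfl p := by
  have h := M.unmarkedIn.orderEmbOfFin_mem rfl p
  simp only [unmarkedIn, Finset.mem_image, Finset.mem_filter, Finset.mem_univ, true_and] at h
  obtain ⟨i, ⟨e, he, hm⟩, hi⟩ := h
  exact ⟨e, i, he, hm, hi⟩

theorem exists_out (M : MultiEdgeColoring S) (q : Fin M.unmarkedOut.card) :
    ∃ e : S.Edge, ∃ j, e.tgt = .outF j ∧ M.θ e e = some (false, false) ∧
      M.Pout.cell j = M.unmarkedOut.orderEmbOfFin rfl q := by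
  have h := M.unmarkedOut.orderEmbOfFin_mem rfl q
  simp only [unmarkedOut, Finset.mem_image, Finset.mem_filter, Finset.mem_univ, true_and] at h
  obtain ⟨j, ⟨e, he, hm⟩, hj⟩ := h
  exact ⟨e, j, he, hm, hj⟩

theorem exists_inF_eq (M : MultiEdgeColoring S) {k : ℕ} (h : k ∈ M.unmarkedIn) :
    ∃ p, (M.unmarkedIn.orderEmbOfFin rfl p : ℕ) = k := by
  have : k ∈ Set.range (M.unmarkedIn.orderEmbOfFin rfl) := by
    rw [Finset.range_orderEmbOfFin]; exact h
  exact this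

theorem exists_outF_eq (M : MultiEdgeColoring S) {k : ℕ} (h : k ∈ M.unmarkedOut) :
    ∃ q, (M.unmarkedOut.orderEmbOfFin rfl q : ℕ) = k := by
  have : k ∈ Set.range (M.unmarkedOut.orderEmbOfFin rfl) := by
    rw [Finset.range_orderEmbOfFin]; exact h
  exact this

theorem mem_unmarkedIn (M : MultiEdgeColoring S) {e : S.Edge} {i} (he : e.src = .inF i)
    (hm : M.θ e e = some (false, false)) : M.Pin.cell i ∈ M.unmarkedIn := by
  simp only [unmarkedIn, Finset.mem_image, Finset.mem_filter, Finset.mem_univ, true_and]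
  exact ⟨i, ⟨e, he, hm⟩, rfl⟩

theorem mem_unmarkedOut (M : MultiEdgeColoring S) {e : S.Edge} {j} (he : e.tgt = .outF j)
    (hm : M.θ e e = some (false, false)) : M.Pout.cell j ∈ M.unmarkedOut := by
  simp only [unmarkedOut, Finset.mem_image, Finset.mem_filter, Finset.mem_univ, true_and]
  exact ⟨j, ⟨e, he, hm⟩, rfl⟩

/-- An edge of the reduced slice: the image of an unmarked edge of the original slice. -/
def ReducedAdj (M : MultiEdgeColoring S)
    (a b : SliceVertex M.unmarkedIn.card M.unmarkedOut.card) : Prop :=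
  ∃ e : S.Edge, M.θ e e = some (false, false) ∧ M.Collapses e.src a ∧ M.Collapses e.tgt b

theorem reduced_in_unique (M : MultiEdgeColoring S) (p : Fin M.unmarkedIn.card) :
    ∃! x, M.ReducedAdj (.inF p) x := by
  obtain ⟨e, i, he, hm, hp⟩ := M.exists_in p
  have key : ∀ x, M.ReducedAdj (.inF p) x → ∀ y, M.ReducedAdj (.inF p) y → x = y := by
    rintro x ⟨e₁, -, hs₁, ht₁⟩ y ⟨e₂, -, hs₂, ht₂⟩
    have h₁ : ∃ i₁, e₁.src = .inF i₁ ∧ M.Pin.cell i₁ = M.unmarkedIn.orderEmbOfFin rfl p := by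
      cases h : e₁.src <;> rw [h] at hs₁ <;> simp [Collapses] at hs₁ ⊢
      exact hs₁
    have h₂ : ∃ i₁, e₂.src = .inF i₁ ∧ M.Pin.cell i₁ = M.unmarkedIn.orderEmbOfFin rfl p := by
      cases h : e₂.src <;> rw [h] at hs₂ <;> simp [Collapses] at hs₂ ⊢
      exact hs₂
    obtain ⟨i₁, hi₁, hc₁⟩ := h₁
    obtain ⟨i₂, hi₂, hc₂⟩ := h₂
    rcases M.in_cell e₁ e₂ ⟨i₁, i₂, hi₁, hi₂, hc₁.trans hc₂.symm⟩ with ⟨a, b⟩ | ⟨j₁, j₂, a, b, hc⟩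
    · rw [a] at ht₁
      rw [b] at ht₂
      cases x <;> cases y <;> simp [Collapses] at ht₁ ht₂ ⊢
    · rw [a] at ht₁
      rw [b] at ht₂
      cases x <;> cases y <;> simp only [Collapses] at ht₁ ht₂ ⊢
      rw [hc, ht₂] at ht₁
      simpa using ht₁.symm
  have ex : ∃ x, M.ReducedAdj (.inF p) x := by
    cases ht : e.tgt with
    | inF k => exact absurd (ht ▸ e.2 : S.Adj e.src (.inF k)) (S.not_adj_in _ _)
    | center => exact ⟨.center, e, hm, by rw [he]; exact hp, by rw [ht]; trivial⟩
    | outF j =>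
      obtain ⟨q, hq⟩ := M.exists_outF_eq (M.mem_unmarkedOut ht hm)
      exact ⟨.outF q, e, hm, by rw [he]; exact hp, by rw [ht]; exact hq.symm⟩
  obtain ⟨x, hx⟩ := ex
  exact ⟨x, hx, fun y hy => key y hy x hx⟩

theorem reduced_out_unique (M : MultiEdgeColoring S) (q : Fin M.unmarkedOut.card) :
    ∃! x, M.ReducedAdj x (.outF q) := by
  obtain ⟨e, j, he, hm, hq⟩ := M.exists_out q
  have key : ∀ x, M.ReducedAdj x (.outF q) → ∀ y, M.ReducedAdj y (.outF q) → x = y := by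
    rintro x ⟨e₁, -, ht₁, hs₁⟩ y ⟨e₂, -, ht₂, hs₂⟩
    have h₁ : ∃ i₁, e₁.tgt = .outF i₁ ∧ M.Pout.cell i₁ = M.unmarkedOut.orderEmbOfFin rfl q := by
      cases h : e₁.tgt <;> rw [h] at hs₁ <;> simp [Collapses] at hs₁ ⊢
      exact hs₁
    have h₂ : ∃ i₁, e₂.tgt = .outF i₁ ∧ M.Pout.cell i₁ = M.unmarkedOut.orderEmbOfFin rfl q := by
      cases h : e₂.tgt <;> rw [h] at hs₂ <;> simp [Collapses] at hs₂ ⊢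
      exact hs₂
    obtain ⟨i₁, hi₁, hc₁⟩ := h₁
    obtain ⟨i₂, hi₂, hc₂⟩ := h₂
    rcases M.out_cell e₁ e₂ ⟨i₁, i₂, hi₁, hi₂, hc₁.trans hc₂.symm⟩ with ⟨a, b⟩ | ⟨j₁, j₂, a, b, hc⟩
    · rw [a] at ht₁
      rw [b] at ht₂
      cases x <;> cases y <;> simp [Collapses] at ht₁ ht₂ ⊢
    · rw [a] at ht₁
      rw [b] at ht₂
      cases x <;> cases y <;> simp only [Collapses] at ht₁ ht₂ ⊢
      rw [hc, ht₂] at ht₁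
      simpa using ht₁.symm
  have ex : ∃ x, M.ReducedAdj x (.outF q) := by
    cases hs : e.src with
    | outF k => exact absurd (hs ▸ e.2 : S.Adj (.outF k) e.tgt) (S.not_out_adj _ _)
    | center => exact ⟨.center, e, hm, by rw [hs]; trivial, by rw [he]; exact hq⟩
    | inF i =>
      obtain ⟨p, hp⟩ := M.exists_inF_eq (M.mem_unmarkedIn hs hm)
      exact ⟨.inF p, e, hm, by rw [hs]; exact hp.symm, by rw [he]; exact hq⟩
  obtain ⟨x, hx⟩ := ex
  exact ⟨x, hx, fun y hy => key y hy x hx⟩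

/-- The reduced version of the slice `S`: every cell is collapsed into a single frontier vertex,
all edges touching the same cell are collapsed into a single edge, and the marked edges are deleted
(together with the frontier vertices that they touch). -/
noncomputable def reducedSlice (M : MultiEdgeColoring S) : UnitSlice T where
  inn := M.unmarkedIn.card
  out := M.unmarkedOut.card
  event := S.event
  Adj := M.ReducedAdj
  not_adj_in := by
    rintro x i ⟨e, -, -, h⟩
    have he : S.Adj e.src e.tgt := e.2
    cases ht : e.tgt with
    | inF k => rw [ht] at he; exact S.not_adj_in _ _ he
    | center => rw [ht] at h; exact h
    | outF k => rw [ht] at h; exact h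
  not_out_adj := by
    rintro j x ⟨e, -, h, -⟩
    have he : S.Adj e.src e.tgt := e.2
    cases hs : e.src with
    | inF k => rw [hs] at h; exact h
    | center => rw [hs] at h; exact h
    | outF k => rw [hs] at he; exact S.not_out_adj _ _ he
  not_loop := by
    rintro ⟨e, -, h, h'⟩
    have he : S.Adj e.src e.tgt := e.2
    cases hs : e.src <;> cases ht : e.tgt <;> rw [hs] at h he <;> rw [ht] at h' he <;>
      first
        | exact S.not_loop he
        | exact h
        | exact h'
  in_unique := M.reduced_in_unique
  out_unique := M.reduced_out_unique

end MultiEdgeColoring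

/-- The values of the colorings and the numbered cells agree on the out-frontier of `S` and the
in-frontier of `S'` (vertices with the same number are identified). -/
def ColoringsAgree {T : Type u} {S S' : UnitSlice T}
    (M : MultiEdgeColoring S) (M' : MultiEdgeColoring S') : Prop :=
  (∀ (e₁ e₂ : S.Edge) (e₁' e₂' : S'.Edge) (j₁ j₂ : Fin S.out) (i₁ i₂ : Fin S'.inn),
    e₁.tgt = .outF j₁ → e₂.tgt = .outF j₂ → e₁'.src = .inF i₁ → e₂'.src = .inF i₂ →
    j₁.val = i₁.val → j₂.val = i₂.val → M.θ e₁ e₂ = M'.θ e₁' e₂') ∧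
  (∀ (j : Fin S.out) (i : Fin S'.inn), j.val = i.val → M.Pout.cell j = M'.Pin.cell i)

theorem ColoringsAgree.unmarked_eq {T : Type u} {S S' : UnitSlice T}
    {M : MultiEdgeColoring S} {M' : MultiEdgeColoring S'} (h : ColoringsAgree M M')
    (hc : S.Composable S') : M.unmarkedOut = M'.unmarkedIn := by
  unfold UnitSlice.Composable at hc
  have lt₁ : ∀ j : Fin S.out, j.val < S'.inn := fun j => by have := j.2; omega
  have lt₂ : ∀ i : Fin S'.inn, i.val < S.out := fun i => by have := i.2; omega
  ext k
  simp only [MultiEdgeColoring.unmarkedIn, MultiEdgeColoring.unmarkedOut, Finset.mem_image,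
    Finset.mem_filter, Finset.mem_univ, true_and]
  constructor
  · rintro ⟨j, ⟨e, he, hm⟩, hk⟩
    obtain ⟨x, hx, -⟩ := S'.in_unique ⟨j.val, lt₁ j⟩
    have hcell := h.2 j ⟨j.val, lt₁ j⟩ rfl
    exact ⟨⟨j.val, lt₁ j⟩, ⟨⟨(_, x), hx⟩, rfl,
      (h.1 e e ⟨(_, x), hx⟩ ⟨(_, x), hx⟩ j j _ _ he he rfl rfl rfl rfl).symm.trans hm⟩,
      hcell.symm.trans hk⟩
  · rintro ⟨i, ⟨e, he, hm⟩, hk⟩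
    obtain ⟨x, hx, -⟩ := S.out_unique ⟨i.val, lt₂ i⟩
    have hcell := h.2 ⟨i.val, lt₂ i⟩ i rfl
    exact ⟨⟨i.val, lt₂ i⟩, ⟨⟨(x, _), hx⟩, rfl,
      (h.1 ⟨(x, _), hx⟩ ⟨(x, _), hx⟩ e e _ _ i i rfl rfl he he rfl rfl).trans hm⟩,
      hcell.trans hk⟩

namespace SliceGraph

variable {T : Type u}

/-- Vertices of the expansion of a slice graph: a vertex together with a multi-edge transitivity
coloring of its label. -/
def ExpandedVertex (G : SliceGraph.{u, v} T) : Type v :=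
  Σ a : G.V, MultiEdgeColoring (G.slice a)

/-- Edges of the expansion of a slice graph. -/
def ExpandedEdge (G : SliceGraph.{u, v} T) (x y : G.ExpandedVertex) : Prop :=
  G.E x.1 y.1 ∧ ColoringsAgree x.2 y.2

/-- The vertex can be reached from an initial vertex and can reach a final vertex of the
expansion, whose vertices are still labeled with the original slices. -/
def IsUseful (G : SliceGraph.{u, v} T) (x : G.ExpandedVertex) : Prop :=
  (∃ y, (G.slice y.1).IsInitial ∧ Relation.ReflTransGen G.ExpandedEdge y x) ∧
  (∃ y, (G.slice y.1).IsFinal ∧ Relation.ReflTransGen G.ExpandedEdge x y)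

instance (G : SliceGraph.{u, v} T) : Finite G.ExpandedVertex := by
  have := G.finite_V
  unfold ExpandedVertex
  infer_instance

/-- The transitive reduction algorithm: expand every vertex by the multi-edge transitivity
colorings of its label, connect coherently colored vertices, delete the vertices that are not
on a walk from an initial to a final vertex, and replace every label by its reduced version. -/
noncomputable def transitiveReduction (G : SliceGraph.{u, v} T) : SliceGraph.{u, v} T where
  V := {x : G.ExpandedVertex // G.IsUseful x}
  finite_V := inferInstance
  E x y := G.ExpandedEdge x.1 y.1
  slice x := x.1.2.reducedSlice
  composable _ _ h := congrArg Finset.card (h.2.unmarked_eq (G.composable _ _ h.1))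

end SliceGraph

/-! Coherent colorings along a word are rigid. Let a word compose to a DAG `H`. Comparing the
sources of two edges of `H` in the order of `H` gives a color: 00 for equal sources, 01 if the first
lies strictly below the second, 10 in the opposite case, 11 if they are incomparable. Call an edge
marked if another edge has the same target and a strictly larger source, that is, if it is implied
by transitivity. These colors, the marks on the diagonal, and the partitions into classes of
parallel edges form a coherent multi-edge coloring of the word (`multiEdgeColoring`,
`coloringsAgree`).

Conversely, every coherent coloring has these colors, marks and classes, up to the numbering of the
cells. Colors are forced from left to right, since (v) decides the comparison of a crossing edge
with the center from edges already compared (`color_eq`). Marks are forced from right to left,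
starting where (vi) reads them at the target (`marked_iff`). Cells contain only parallel edges by
(a), and all of them by (d) (`parallel_of_sameCell_of_agree`, `sameCell_of_parallel`). So the
reduced slices compose to the transitive reduction `H.reduct` (`isUnitDecomposition_reduct`).

A DAG `K` composed from a word of the reduced graph is thus isomorphic to some `H.reduct` with `H`
composed from a word of the original graph. Here non-degeneracy ensures that a slice with reduced
label initial or final was so already. As `H.reduct` induces the same order as `H` (`reduct_lt`), a
topological ordering of `K` is one of `H`. Weak saturation supplies a decomposition of `H` along it;
coloring this decomposition by `H` and reducing gives the required decomposition of `K`. -/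

/-! ### Edges of a unit slice -/

namespace UnitSlice.Edge

variable {T : Type u} {S : UnitSlice T}

theorem src_cases (e : S.Edge) : (∃ i, e.src = .inF i) ∨ e.src = .center := by
  have he : S.Adj e.src e.tgt := e.2
  cases h : e.src with
  | inF i => exact Or.inl ⟨i, rfl⟩
  | center => exact Or.inr rfl
  | outF j => exact absurd (h ▸ he) (S.not_out_adj _ _)

theorem tgt_cases (e : S.Edge) : e.tgt = .center ∨ ∃ j, e.tgt = .outF j := by
  have he : S.Adj e.src e.tgt := e.2
  cases h : e.tgt with
  | inF i => exact absurd (h ▸ he) (S.not_adj_in _ _)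
  | center => exact Or.inl rfl
  | outF j => exact Or.inr ⟨j, rfl⟩

theorem tgt_ne_center {e : S.Edge} (h : e.src = .center) : e.tgt ≠ .center := by
  intro h'
  have he : S.Adj e.src e.tgt := e.2
  rw [h, h'] at he
  exact S.not_loop he

theorem ext_of_src {e e' : S.Edge} {i} (h : e.src = .inF i) (h' : e'.src = .inF i) : e = e' := by
  have he : S.Adj e.src e.tgt := e.2
  have he' : S.Adj e'.src e'.tgt := e'.2
  rw [h] at he
  rw [h'] at he'
  exact Subtype.ext (Prod.ext (h.trans h'.symm) ((S.in_unique i).unique he he'))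

theorem ext_of_tgt {e e' : S.Edge} {j} (h : e.tgt = .outF j) (h' : e'.tgt = .outF j) : e = e' := by
  have he : S.Adj e.src e.tgt := e.2
  have he' : S.Adj e'.src e'.tgt := e'.2
  rw [h] at he
  rw [h'] at he'
  exact Subtype.ext (Prod.ext ((S.out_unique j).unique he he') (h.trans h'.symm))

theorem exists_src (i : Fin S.inn) : ∃ e : S.Edge, e.src = .inF i := by
  obtain ⟨x, hx, -⟩ := S.in_unique i
  exact ⟨⟨(_, x), hx⟩, rfl⟩

theorem exists_tgt (j : Fin S.out) : ∃ e : S.Edge, e.tgt = .outF j := by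
  obtain ⟨x, hx, -⟩ := S.out_unique j
  exact ⟨⟨(x, _), hx⟩, rfl⟩

/-- Two edges are consecutive at the center only. -/
theorem src_eq_tgt_iff (e₁ e₂ : S.Edge) :
    e₁.src = e₂.tgt ↔ e₁.src = .center ∧ e₂.tgt = .center := by
  constructor
  · intro h
    rcases e₁.src_cases with ⟨i, hi⟩ | hc
    · rcases e₂.tgt_cases with hc | ⟨j, hj⟩
      · rw [hi, hc] at h; cases h
      · rw [hi, hj] at h; cases h
    · exact ⟨hc, h ▸ hc⟩
  · rintro ⟨h, h'⟩
    rw [h, h']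

end UnitSlice.Edge

/-! ### Chains of glued edge parts -/

section Gluing

variable {T : Type u} {n : ℕ} {w : Fin n → UnitSlice T}

/-- Each frontier vertex is touched by one edge, so gluing is a partial injection, here and in
`Glued.leftUnique`. -/
theorem Glued.rightUnique : Relator.RightUnique (Glued w) := by
  rintro x ⟨i, e⟩ ⟨j, e'⟩ ⟨h₁, k, l, hk, hl, hkl⟩ ⟨h₂, k', l', hk', hl', hkl'⟩
  obtain rfl : i = j := Fin.ext (h₁.symm.trans h₂)
  rw [hk] at hk'
  cases hk'
  obtain rfl : l = l' := Fin.ext (hkl.symm.trans hkl')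
  exact congrArg (Sigma.mk i) (UnitSlice.Edge.ext_of_src hl hl')

theorem Glued.leftUnique : Relator.LeftUnique (Glued w) := by
  rintro ⟨i, e⟩ ⟨j, e'⟩ x ⟨h₁, k, l, hk, hl, hkl⟩ ⟨h₂, k', l', hk', hl', hkl'⟩
  obtain rfl : i = j := Fin.ext (Nat.add_right_cancel (h₁.trans h₂.symm))
  rw [hl] at hl'
  cases hl'
  obtain rfl : k = k' := Fin.ext (hkl.trans hkl'.symm)
  exact congrArg (Sigma.mk i) (UnitSlice.Edge.ext_of_tgt hk hk')

/-- As gluing is a partial injection, its classes are chains, so any two members are linked in one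
direction. -/
theorem Glued.reflTransGen_total {x y : Σ i, (w i).Edge} (h : Relation.EqvGen (Glued w) x y) :
    Relation.ReflTransGen (Glued w) x y ∨ Relation.ReflTransGen (Glued w) y x := by
  have swap : Relator.RightUnique (Function.swap (Glued w)) :=
    fun _ _ _ h₁ h₂ => Glued.leftUnique h₁ h₂
  induction h with
  | rel x y h => exact Or.inl (.single h)
  | refl x => exact Or.inl .refl
  | symm x y _ ih => exact ih.symm
  | trans x y z _ _ ih₁ ih₂ =>
    rcases ih₁ with h₁ | h₁ <;> rcases ih₂ with h₂ | h₂
    · exact Or.inl (h₁.trans h₂)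
    · have := Relation.ReflTransGen.total_of_right_unique swap
        (Relation.reflTransGen_swap.2 h₁) (Relation.reflTransGen_swap.2 h₂)
      simpa only [Relation.reflTransGen_swap, or_comm] using this
    · exact Relation.ReflTransGen.total_of_right_unique Glued.rightUnique h₁ h₂
    · exact Or.inr (h₂.trans h₁)

/-- The slice index grows by one at each gluing. Hence a chain meets each slice at most once, which
is what separates the edges of one slice in the composition. -/
theorem Glued.fst_le_of_reflTransGen {x y : Σ i, (w i).Edge}
    (h : Relation.ReflTransGen (Glued w) x y) : x.1.val ≤ y.1.val ∧ (x.1.val = y.1.val → x = y) := by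
  induction h with
  | refl => exact ⟨le_rfl, fun _ => rfl⟩
  | tail _ h ih =>
    have := h.1
    exact ⟨by omega, fun _ => by omega⟩

theorem IsSliceWord.exists_next (hw : IsSliceWord w) {i : Fin n} {e : (w i).Edge} {k}
    (hk : e.tgt = .outF k) : ∃ y, Glued w ⟨i, e⟩ y := by
  by_cases hi : i.val + 1 = n
  · have h0 : (w i).out = 0 := hw.2.1 i hi
    have := k.2
    omega
  · have hlt : i.val + 1 < n := by have := i.2; omega
    have hc : (w i).out = (w ⟨i.val + 1, hlt⟩).inn := hw.2.2 i ⟨i.val + 1, hlt⟩ rfl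
    obtain ⟨e', he'⟩ := UnitSlice.Edge.exists_src (S := w ⟨i.val + 1, hlt⟩) (Fin.cast hc k)
    exact ⟨⟨_, e'⟩, rfl, k, _, hk, he', rfl⟩

theorem IsSliceWord.exists_prev (hw : IsSliceWord w) {i : Fin n} {e : (w i).Edge} {k}
    (hk : e.src = .inF k) : ∃ y, Glued w y ⟨i, e⟩ := by
  by_cases hi : i.val = 0
  · have h0 : (w i).inn = 0 := hw.1 i hi
    have := k.2
    omega
  · have hlt : i.val - 1 < n := by have := i.2; omega
    have hs : i.val - 1 + 1 = i.val := by omega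
    have hc : (w ⟨i.val - 1, hlt⟩).out = (w i).inn := hw.2.2 ⟨i.val - 1, hlt⟩ i hs
    obtain ⟨e', he'⟩ := UnitSlice.Edge.exists_tgt (S := w ⟨i.val - 1, hlt⟩) (Fin.cast hc.symm k)
    exact ⟨⟨_, e'⟩, hs, _, k, he', hk, rfl⟩

/-- Induction along the sliced parts of an edge, starting at its target. -/
theorem IsSliceWord.induction_tgt (hw : IsSliceWord w) {P : (Σ i, (w i).Edge) → Prop}
    (center : ∀ x, x.2.tgt = .center → P x) (step : ∀ x y, Glued w x y → P y → P x) (x) : P x := by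
  -- Parts move to the right, so the number of remaining slices decreases.
  obtain ⟨m, hm⟩ : ∃ m, n - x.1.val = m := ⟨_, rfl⟩
  induction m generalizing x with
  | zero => have := x.1.2; omega
  | succ m ih =>
    obtain ⟨i, e⟩ := x
    rcases e.tgt_cases with h | ⟨j, hj⟩
    · exact center _ h
    · obtain ⟨y, hy⟩ := hw.exists_next hj
      have := hy.1
      exact step _ y hy (ih y (by omega))

/-- Induction along the sliced parts of an edge, starting at its source. -/
theorem IsSliceWord.induction_src (hw : IsSliceWord w) {P : (Σ i, (w i).Edge) → Prop}
    (center : ∀ x, x.2.src = .center → P x) (step : ∀ x y, Glued w x y → P x → P y) (x) : P x := by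
  obtain ⟨m, hm⟩ : ∃ m, x.1.val = m := ⟨_, rfl⟩
  induction m using Nat.strong_induction_on generalizing x with
  | _ m ih =>
    obtain ⟨i, e⟩ := x
    rcases e.src_cases with ⟨j, hj⟩ | h
    · obtain ⟨y, hy⟩ := hw.exists_prev hj
      have := hy.1
      exact step y _ hy (ih y.1.val (by omega) y rfl)
    · exact center _ h

theorem Glued.src_ne_center {x y : Σ i, (w i).Edge} (h : Glued w x y) : y.2.src ≠ .center := by
  obtain ⟨-, k, l, -, hl, -⟩ := h
  simp [hl]

theorem Glued.tgt_ne_center {x y : Σ i, (w i).Edge} (h : Glued w x y) : x.2.tgt ≠ .center := by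
  obtain ⟨-, k, l, hk, -, -⟩ := h
  simp [hk]

end Gluing

/-! ### Unit decompositions and positions of edges -/

/-- `part` exhibits `w` as a unit decomposition of `H`: it is constant along gluing and separates
the edges of each slice. -/
structure IsDecomposition {T : Type u} {n : ℕ} (w : Fin n → UnitSlice T) (H : DAG T)
    (c : Fin n ≃ H.V) (part : (Σ i, (w i).Edge) → H.E) : Prop where
  word : IsSliceWord w
  label : ∀ i, H.label (c i) = (w i).event
  surjective : Function.Surjective part
  glued : ∀ {x y}, Glued w x y → part x = part y
  inj : ∀ {i} {e e' : (w i).Edge}, part ⟨i, e⟩ = part ⟨i, e'⟩ → e = e'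
  src_center : ∀ {x}, x.2.src = .center → H.src (part x) = c x.1
  tgt_center : ∀ {x}, x.2.tgt = .center → H.tgt (part x) = c x.1

namespace IsDecomposition

variable {T : Type u} {n : ℕ} {w : Fin n → UnitSlice T} {H : DAG T}
  {c : Fin n ≃ H.V} {part : (Σ i, (w i).Edge) → H.E}

theorem pos_src_le (D : IsDecomposition w H c part) (x) :
    (c.symm (H.src (part x))).val ≤ x.1.val := by
  refine D.word.induction_src (P := fun x => (c.symm (H.src (part x))).val ≤ x.1.val) ?_ ?_ x
  · intro x hx
    rw [D.src_center hx, c.symm_apply_apply]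
  · intro x y h hx
    rw [← D.glued h]
    have := h.1
    omega

theorem le_pos_tgt (D : IsDecomposition w H c part) (x) :
    x.1.val ≤ (c.symm (H.tgt (part x))).val := by
  refine D.word.induction_tgt (P := fun x => x.1.val ≤ (c.symm (H.tgt (part x))).val) ?_ ?_ x
  · intro x hx
    rw [D.tgt_center hx, c.symm_apply_apply]
  · intro x y h hx
    rw [D.glued h]
    have := h.1
    omega

/-- A part coming from the in-frontier has a predecessor in an earlier slice, so its source sits
strictly before `i`. Touching the center thus depends only on the edge of `H`, and passes between
parallel edges. -/
theorem src_eq_center_iff (D : IsDecomposition w H c part) {i} (e : (w i).Edge) :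
    e.src = .center ↔ H.src (part ⟨i, e⟩) = c i := by
  refine ⟨fun h => D.src_center (x := ⟨i, e⟩) h, fun h => ?_⟩
  rcases e.src_cases with ⟨k, hk⟩ | hc
  · obtain ⟨y, hy⟩ := D.word.exists_prev hk
    have h1 := D.pos_src_le y
    have := hy.1
    rw [D.glued hy, h, c.symm_apply_apply] at h1
    simp only at this
    omega
  · exact hc

theorem tgt_eq_center_iff (D : IsDecomposition w H c part) {i} (e : (w i).Edge) :
    e.tgt = .center ↔ H.tgt (part ⟨i, e⟩) = c i := by
  refine ⟨fun h => D.tgt_center (x := ⟨i, e⟩) h, fun h => ?_⟩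
  rcases e.tgt_cases with hc | ⟨k, hk⟩
  · exact hc
  · obtain ⟨y, hy⟩ := D.word.exists_next hk
    have h1 := D.le_pos_tgt y
    have := hy.1
    rw [← D.glued hy, h, c.symm_apply_apply] at h1
    simp only at this
    omega

/-- Equality of positions would leave a part with both ends at the center, a loop. -/
theorem pos_src_lt_tgt (D : IsDecomposition w H c part) (ε : H.E) :
    c.symm (H.src ε) < c.symm (H.tgt ε) := by
  obtain ⟨⟨i, e⟩, rfl⟩ := D.surjective ε
  have h1 := D.pos_src_le ⟨i, e⟩
  have h2 := D.le_pos_tgt ⟨i, e⟩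
  refine lt_of_le_of_ne (h1.trans h2) fun h => ?_
  have h3 : c.symm (H.src (part ⟨i, e⟩)) = i := Fin.ext (le_antisymm h1 (h ▸ h2))
  have h4 : c.symm (H.tgt (part ⟨i, e⟩)) = i := h ▸ h3
  exact UnitSlice.Edge.tgt_ne_center ((D.src_eq_center_iff e).2 (c.symm_apply_eq.1 h3))
    ((D.tgt_eq_center_iff e).2 (c.symm_apply_eq.1 h4))

theorem pos_lt (D : IsDecomposition w H c part) {a b : H.V} (h : H.Lt a b) :
    c.symm a < c.symm b := by
  induction h with
  | single h =>
    obtain ⟨ε, rfl, rfl⟩ := h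
    exact D.pos_src_lt_tgt ε
  | tail _ h ih =>
    obtain ⟨ε, rfl, rfl⟩ := h
    exact ih.trans (D.pos_src_lt_tgt ε)

theorem exists_tgt_part (D : IsDecomposition w H c part) (ε : H.E) {i} (h : H.tgt ε = c i) :
    ∃ e : (w i).Edge, e.tgt = .center ∧ part ⟨i, e⟩ = ε := by
  obtain ⟨x, rfl⟩ := D.surjective ε
  revert h
  refine D.word.induction_tgt (P := fun x => H.tgt (part x) = c i →
    ∃ e : (w i).Edge, e.tgt = .center ∧ part ⟨i, e⟩ = part x) ?_ ?_ x
  · rintro ⟨j, e⟩ hx h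
    rw [D.tgt_center hx] at h
    obtain rfl : j = i := c.injective h
    exact ⟨e, hx, rfl⟩
  · intro x y h ih
    rw [D.glued h]
    exact ih

theorem exists_src_part (D : IsDecomposition w H c part) (ε : H.E) {i} (h : H.src ε = c i) :
    ∃ e : (w i).Edge, e.src = .center ∧ part ⟨i, e⟩ = ε := by
  obtain ⟨x, rfl⟩ := D.surjective ε
  revert h
  refine D.word.induction_src (P := fun x => H.src (part x) = c i →
    ∃ e : (w i).Edge, e.src = .center ∧ part ⟨i, e⟩ = part x) ?_ ?_ x
  · rintro ⟨j, e⟩ hx h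
    rw [D.src_center hx] at h
    obtain rfl : j = i := c.injective h
    exact ⟨e, hx, rfl⟩
  · intro x y h ih
    rw [← D.glued h]
    exact ih

/-- Recovers the gluing classes from the local fields `glued` and `inj`: follow the chain of `x`
until it reaches the slice of `y`, where `inj` applies. The chain cannot stop earlier, as no part
lies beyond the target of its edge. -/
theorem eqvGen_of_part_eq (D : IsDecomposition w H c part) (x) :
    ∀ y, part x = part y → x.1 ≤ y.1 → Relation.EqvGen (Glued w) x y := by
  refine D.word.induction_tgt (P := fun x => ∀ y, part x = part y → x.1 ≤ y.1 →
    Relation.EqvGen (Glued w) x y) ?_ ?_ x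
  · rintro ⟨i, e⟩ hx ⟨j, e'⟩ h hle
    have h1 := D.le_pos_tgt ⟨j, e'⟩
    rw [← h, D.tgt_center hx, c.symm_apply_apply] at h1
    obtain rfl : i = j := le_antisymm hle h1
    rw [D.inj h]
    exact .refl _
  · rintro ⟨i, e⟩ y hy ih ⟨j, e'⟩ h hle
    rcases hle.eq_or_lt with rfl | hlt
    · rw [D.inj h]
      exact .refl _
    · exact .trans _ _ _ (.rel _ _ hy) (ih _ ((D.glued hy).symm.trans h) (by
        have := hy.1
        have : i.val < j.val := hlt
        show y.1.val ≤ j.val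
        simp only at *
        omega))

theorem isUnitDecomposition (D : IsDecomposition w H c part) : IsUnitDecomposition w H c := by
  refine ⟨D.word, D.label, part, D.surjective, fun x y => ⟨fun h => ?_, fun h => ?_⟩,
    fun x => D.src_center, fun x => D.tgt_center⟩
  · rcases le_total x.1 y.1 with hle | hle
    · exact D.eqvGen_of_part_eq x y h hle
    · exact (D.eqvGen_of_part_eq y x h.symm hle).symm
  · induction h with
    | rel x y h => exact D.glued h
    | refl => rfl
    | symm _ _ _ ih => exact ih.symm
    | trans _ _ _ _ _ ih₁ ih₂ => exact ih₁.trans ih₂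

end IsDecomposition

theorem IsUnitDecomposition.exists_part {T : Type u} {n : ℕ} {w : Fin n → UnitSlice T} {H : DAG T}
    {c : Fin n ≃ H.V} (h : IsUnitDecomposition w H c) : ∃ part, IsDecomposition w H c part := by
  obtain ⟨hw, hl, part, hsurj, hpart, hs, ht⟩ := h
  refine ⟨part, hw, hl, hsurj, fun h => (hpart _ _).2 (.rel _ _ h), fun {i e e'} h => ?_,
    fun {x} => hs x, fun {x} => ht x⟩
  rcases Glued.reflTransGen_total ((hpart _ _).1 h) with h | h
  · simpa using (Glued.fst_le_of_reflTransGen h).2 rfl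
  · simpa [eq_comm] using (Glued.fst_le_of_reflTransGen h).2 rfl

/-! ### Existence and uniqueness of the composed DAG -/

section Composition

variable {T : Type u} {n : ℕ} {w : Fin n → UnitSlice T}

theorem IsSliceWord.exists_origin (hw : IsSliceWord w) (x) :
    ∃ o, Relation.ReflTransGen (Glued w) o x ∧ o.2.src = .center :=
  hw.induction_src (P := fun x => ∃ o, Relation.ReflTransGen (Glued w) o x ∧ o.2.src = .center)
    (fun x hx => ⟨x, .refl, hx⟩) (fun _ _ h ⟨o, ho, hc⟩ => ⟨o, ho.tail h, hc⟩) x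

theorem IsSliceWord.exists_end (hw : IsSliceWord w) (x) :
    ∃ z, Relation.ReflTransGen (Glued w) x z ∧ z.2.tgt = .center :=
  hw.induction_tgt (P := fun x => ∃ z, Relation.ReflTransGen (Glued w) x z ∧ z.2.tgt = .center)
    (fun x hx => ⟨x, .refl, hx⟩) (fun _ _ h ⟨z, hz, hc⟩ => ⟨z, .head h hz, hc⟩) x

/-- A part at the right of a gluing does not leave a center, so only the first part of a chain can.
-/
theorem Glued.eq_of_eqvGen_of_src {x y : Σ i, (w i).Edge} (h : Relation.EqvGen (Glued w) x y)
    (hx : x.2.src = .center) (hy : y.2.src = .center) : x = y := by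
  rcases Glued.reflTransGen_total h with h | h
  · rcases Relation.ReflTransGen.cases_tail h with h | ⟨z, -, hz⟩
    · exact h.symm
    · exact absurd hy hz.src_ne_center
  · rcases Relation.ReflTransGen.cases_tail h with h | ⟨z, -, hz⟩
    · exact h
    · exact absurd hx hz.src_ne_center

theorem Glued.eq_of_eqvGen_of_tgt {x y : Σ i, (w i).Edge} (h : Relation.EqvGen (Glued w) x y)
    (hx : x.2.tgt = .center) (hy : y.2.tgt = .center) : x = y := by
  rcases Glued.reflTransGen_total h with h | h
  · rcases Relation.ReflTransGen.cases_head h with h | ⟨z, hz, -⟩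
    · exact h
    · exact absurd hx hz.tgt_ne_center
  · rcases Relation.ReflTransGen.cases_head h with h | ⟨z, hz, -⟩
    · exact h.symm
    · exact absurd hy hz.tgt_ne_center

theorem Glued.eqvGen_of_reflTransGen {x y : Σ i, (w i).Edge}
    (h : Relation.ReflTransGen (Glued w) x y) : Relation.EqvGen (Glued w) x y := by
  induction h with
  | refl => exact .refl _
  | tail _ h ih => exact .trans _ _ _ ih (.rel _ _ h)

/-- Every slice word can be composed. -/
theorem IsSliceWord.exists_composition (hw : IsSliceWord w) :
    ∃ (H : DAG T) (c : Fin n ≃ H.V) (part : (Σ i, (w i).Edge) → H.E),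
      IsDecomposition w H c part := by
  choose origin horigin hsrc using hw.exists_origin
  choose fin hfin htgt using hw.exists_end
  -- An edge of the composition is represented by its first part; `fin` finds its last part, hence
  -- its target.
  let E := {x : Σ i, (w i).Edge // x.2.src = .center}
  have hlt : ∀ x : E, x.1.1 < (fin x.1).1 := by
    intro x
    rcases Relation.ReflTransGen.cases_head (hfin x.1) with h | ⟨z, hz, h⟩
    · have := htgt x.1
      rw [← h] at this
      exact absurd this (UnitSlice.Edge.tgt_ne_center x.2)
    · have h1 := hz.1
      have h2 := (Glued.fst_le_of_reflTransGen h).1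
      show x.1.1.val < (fin x.1).1.val
      omega
  have hac : ∀ a b, Relation.TransGen
      (fun a b => ∃ e : E, e.1.1 = a ∧ (fin e.1).1 = b) a b → a < b := by
    intro a b h
    induction h with
    | single h =>
      obtain ⟨e, rfl, rfl⟩ := h
      exact hlt e
    | tail _ h ih =>
      obtain ⟨e, rfl, rfl⟩ := h
      exact ih.trans (hlt e)
  have horig : ∀ x, Relation.EqvGen (Glued w) (origin x) x :=
    fun x => Glued.eqvGen_of_reflTransGen (horigin x)
  refine ⟨⟨Fin n, E, fun e => e.1.1, fun e => (fin e.1).1, fun i => (w i).event,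
    fun x h => (hac x x h).false⟩, Equiv.refl _, fun x => ⟨origin x, hsrc x⟩, hw, fun _ => rfl,
    ?_, ?_, ?_, ?_, ?_⟩
  · rintro ⟨x, hx⟩
    exact ⟨x, Subtype.ext (Glued.eq_of_eqvGen_of_src (horig x) (hsrc x) hx)⟩
  · intro x y h
    exact Subtype.ext (Glued.eq_of_eqvGen_of_src
      (.trans _ _ _ (horig x) (.trans _ _ _ (.rel _ _ h) (.symm _ _ (horig y)))) (hsrc x) (hsrc y))
  · intro i e e' h
    have h' : origin ⟨i, e⟩ = origin ⟨i, e'⟩ := congrArg Subtype.val h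
    have h1 := horig ⟨i, e⟩
    rw [h'] at h1
    rcases Glued.reflTransGen_total ((h1.symm _ _).trans _ _ _ (horig ⟨i, e'⟩)) with h | h
    · simpa using (Glued.fst_le_of_reflTransGen h).2 rfl
    · simpa [eq_comm] using (Glued.fst_le_of_reflTransGen h).2 rfl
  · intro x hx
    exact congrArg Sigma.fst (Glued.eq_of_eqvGen_of_src (horig x) (hsrc x) hx)
  · intro x hx
    have h : fin (origin x) = x := Glued.eq_of_eqvGen_of_tgt
      (.trans _ _ _ (.symm _ _ (Glued.eqvGen_of_reflTransGen (hfin _))) (horig x)) (htgt _) hx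
    exact congrArg Sigma.fst h

end Composition

/-- The DAG composed from a slice word is unique up to isomorphism. -/
theorem IsUnitDecomposition.exists_edgeEquiv {T : Type u} {n : ℕ} {w : Fin n → UnitSlice T}
    {H K : DAG T} {c : Fin n ≃ H.V} {d : Fin n ≃ K.V} (h : IsUnitDecomposition w H c)
    (h' : IsUnitDecomposition w K d) : ∃ φ : H.E ≃ K.E,
      ∀ ε, K.src (φ ε) = d (c.symm (H.src ε)) ∧ K.tgt (φ ε) = d (c.symm (H.tgt ε)) := by
  obtain ⟨hw, -, p, hsurj, hp, hs, ht⟩ := h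
  obtain ⟨-, -, q, hsurj', hq, hs', ht'⟩ := h'
  -- Both edge sets are the quotient of the same set of parts by gluing.
  have hpq : ∀ x y, p x = p y ↔ q x = q y := fun x y => (hp x y).trans (hq x y).symm
  choose r hr using hsurj
  have hbij : Function.Bijective fun ε => q (r ε) := by
    refine ⟨fun a b hab => ?_, fun b => ?_⟩
    · exact (hr a).symm.trans (((hpq _ _).2 hab).trans (hr b))
    · obtain ⟨x, rfl⟩ := hsurj' b
      exact ⟨p x, (hpq _ _).1 (hr _)⟩
  refine ⟨Equiv.ofBijective _ hbij, fun ε => ?_⟩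
  simp only [Equiv.ofBijective_apply]
  obtain ⟨o, ho, hoc⟩ := hw.exists_origin (r ε)
  obtain ⟨z, hz, hzc⟩ := hw.exists_end (r ε)
  have ho := Glued.eqvGen_of_reflTransGen ho
  have hz := Glued.eqvGen_of_reflTransGen hz
  rw [← (hq _ _).2 ho, hs' o hoc, (hq _ _).2 ho, (hq _ _).2 hz, ht' z hzc]
  have h1 : H.src ε = c o.1 := by rw [← hs o hoc, (hp _ _).2 ho, hr]
  have h2 : H.tgt ε = c z.1 := by rw [← ht z hzc, ← (hp _ _).2 hz, hr]
  rw [h1, h2]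
  simp

theorem IsUnitDecomposition.congr {T : Type u} {n : ℕ} {w : Fin n → UnitSlice T}
    {H K : DAG T} {c : Fin n ≃ H.V} (h : IsUnitDecomposition w H c) (ψ : H.V ≃ K.V) (φ : H.E ≃ K.E)
    (hφ : ∀ ε, K.src (φ ε) = ψ (H.src ε) ∧ K.tgt (φ ε) = ψ (H.tgt ε))
    (hψ : ∀ v, K.label (ψ v) = H.label v) : IsUnitDecomposition w K (c.trans ψ) := by
  obtain ⟨hw, hl, p, hsurj, hp, hs, ht⟩ := h
  refine ⟨hw, fun i => ?_, φ ∘ p, φ.surjective.comp hsurj, fun x y => ?_, fun x hx => ?_,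
    fun x hx => ?_⟩
  · rw [Equiv.trans_apply, hψ, hl]
  · rw [← hp]
    exact φ.injective.eq_iff
  · rw [Function.comp_apply, (hφ _).1, hs x hx, Equiv.trans_apply]
  · rw [Function.comp_apply, (hφ _).2, ht x hx, Equiv.trans_apply]

/-! ### The order of a DAG, its marked edges and its colors -/

namespace DAG

variable {T : Type u} (H : DAG T)

/-- The reflexive partial order induced by a DAG. -/
def Le (a b : H.V) : Prop := a = b ∨ H.Lt a b

variable {H}

theorem Lt.irrefl (a : H.V) : ¬ H.Lt a a := H.acyclic a

theorem Lt.trans {a b d : H.V} (h : H.Lt a b) (h' : H.Lt b d) : H.Lt a d :=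
  Relation.TransGen.trans h h'

theorem Lt.edge (ε : H.E) : H.Lt (H.src ε) (H.tgt ε) := .single ⟨ε, rfl, rfl⟩

theorem Le.antisymm {a b : H.V} (h : H.Le a b) (h' : H.Le b a) : a = b := by
  rcases h with h | h
  · exact h
  · rcases h' with h' | h'
    · exact h'.symm
    · exact absurd (h.trans h') (Lt.irrefl a)

theorem lt_iff_le_not_le {a b : H.V} : H.Lt a b ↔ H.Le a b ∧ ¬ H.Le b a := by
  constructor
  · intro h
    refine ⟨Or.inr h, fun h' => ?_⟩
    have := Le.antisymm (Or.inr h) h'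
    subst this
    exact Lt.irrefl _ h
  · rintro ⟨h | h, h'⟩
    · exact absurd (Or.inl h.symm) h'
    · exact h

/-- Splits off the last edge of a path, so that comparisons with a center can be made through the
edges entering it. -/
theorem lt_edge_iff {a : H.V} {b : H.V} :
    H.Lt a b ↔ ∃ ε, H.tgt ε = b ∧ H.Le a (H.src ε) := by
  constructor
  · intro h
    cases h with
    | single h =>
      obtain ⟨ε, h, h'⟩ := h
      exact ⟨ε, h', Or.inl h.symm⟩
    | tail h' h =>
      obtain ⟨ε, rfl, h⟩ := h
      exact ⟨ε, h, Or.inr h'⟩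
  · rintro ⟨ε, rfl, h | h⟩
    · rw [h]
      exact Lt.edge ε
    · exact h.trans (Lt.edge ε)

variable (H)

/-- An edge is marked if it is implied by transitivity. -/
def IsMarked (ε : H.E) : Prop := ∃ ε', H.tgt ε' = H.tgt ε ∧ H.Lt (H.src ε) (H.src ε')

/-- Multiple edges. -/
def Parallel (ε ε' : H.E) : Prop := H.src ε = H.src ε' ∧ H.tgt ε = H.tgt ε'

open Classical in
/-- The color of a pair of edges with comparable or incomparable sources. -/
noncomputable def color (ε ε' : H.E) : Bool × Bool :=
  (decide (¬ H.Le (H.src ε) (H.src ε')), decide (¬ H.Le (H.src ε') (H.src ε)))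

variable {H}

theorem color_swap {ε ε' : H.E} {a b} (h : H.color ε ε' = (a, b)) : H.color ε' ε = (b, a) := by
  simp only [color, Prod.mk.injEq] at h ⊢
  exact h.symm

theorem color_of_src_eq {ε ε' : H.E} (h : H.src ε = H.src ε') :
    H.color ε ε' = (false, false) := by
  simp [color, h, Le]

theorem color_eq_false_false {ε ε' : H.E} :
    H.color ε ε' = (false, false) ↔ H.src ε = H.src ε' := by
  refine ⟨fun h => ?_, color_of_src_eq⟩
  simp only [color, Prod.mk.injEq, decide_eq_false_iff_not, not_not] at h
  exact h.1.antisymm h.2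

theorem color_eq_false_true {ε ε' : H.E} :
    H.color ε ε' = (false, true) ↔ H.Lt (H.src ε) (H.src ε') := by
  simp [color, lt_iff_le_not_le]

theorem color_eq_false {ε ε' : H.E} :
    (H.color ε ε' = (false, false) ∨ H.color ε ε' = (false, true)) ↔
      H.Le (H.src ε) (H.src ε') := by
  rw [color_eq_false_true, color_eq_false_false, Le]

theorem color_eq_true_true {ε ε' : H.E} (h : ¬ H.Le (H.src ε) (H.src ε'))
    (h' : ¬ H.Le (H.src ε') (H.src ε)) : H.color ε ε' = (true, true) := by
  simp [color, h, h']

theorem Parallel.isMarked_iff {ε ε' : H.E} (h : H.Parallel ε ε') :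
    H.IsMarked ε ↔ H.IsMarked ε' := by
  rw [IsMarked, IsMarked, h.1, h.2]

theorem Parallel.color_eq {ε ε' : H.E} (h : H.Parallel ε ε') (δ : H.E) :
    H.color δ ε = H.color δ ε' := by
  rw [color, color, h.1]

end DAG

/-! ### The coherent coloring that a DAG induces on its decompositions -/

namespace NumberedPartition

variable {α : Type*} {m : ℕ}

/-- The partition into fibers, numbered arbitrarily. -/
noncomputable def ofFun (f : Fin m → α) : NumberedPartition m where
  cell i := (Finite.equivFin (Set.range f) ⟨f i, i, rfl⟩).val
  numbered := by
    refine ⟨Nat.card (Set.range f), Set.ext fun k => ⟨?_, fun hk => ?_⟩⟩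
    · rintro ⟨i, rfl⟩
      exact (Finite.equivFin (Set.range f) ⟨f i, i, rfl⟩).2
    · obtain ⟨⟨_, i, rfl⟩, hi⟩ := (Finite.equivFin (Set.range f)).surjective ⟨k, hk⟩
      exact ⟨i, congrArg Fin.val hi⟩

theorem ofFun_cell_eq_iff (f : Fin m → α) (i j : Fin m) :
    (ofFun f).cell i = (ofFun f).cell j ↔ f i = f j := by
  simp only [ofFun, Fin.val_inj, EmbeddingLike.apply_eq_iff_eq]
  exact Subtype.ext_iff

/-- The numbering is arbitrary but is determined by the function alone, so glued frontiers receive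
identical cell numbers and not merely the same partition. -/
theorem ofFun_cell_congr {m' : ℕ} (hm : m = m') {f : Fin m → α} {g : Fin m' → α}
    (h : ∀ i j, i.val = j.val → f i = g j) {i j} (hij : i.val = j.val) :
    (ofFun f).cell i = (ofFun g).cell j := by
  subst hm
  obtain rfl : f = g := funext fun i => h i i rfl
  rw [Fin.ext hij]

end NumberedPartition

namespace UnitSlice

variable {T : Type u} (S : UnitSlice T)

/-- The edge touching an in-frontier vertex. -/
noncomputable def inEdge (k : Fin S.inn) : S.Edge := (Edge.exists_src k).choose

/-- The edge touching an out-frontier vertex. -/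
noncomputable def outEdge (k : Fin S.out) : S.Edge := (Edge.exists_tgt k).choose

theorem inEdge_src (k : Fin S.inn) : (S.inEdge k).src = .inF k := (Edge.exists_src k).choose_spec

theorem outEdge_tgt (k : Fin S.out) : (S.outEdge k).tgt = .outF k :=
  (Edge.exists_tgt k).choose_spec

variable {S}

theorem eq_inEdge {e : S.Edge} {k} (h : e.src = .inF k) : e = S.inEdge k :=
  Edge.ext_of_src h (S.inEdge_src k)

theorem eq_outEdge {e : S.Edge} {k} (h : e.tgt = .outF k) : e = S.outEdge k :=
  Edge.ext_of_tgt h (S.outEdge_tgt k)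

end UnitSlice

namespace IsDecomposition

variable {T : Type u} {n : ℕ} {w : Fin n → UnitSlice T} {H : DAG T}
  {c : Fin n ≃ H.V} {part : (Σ i, (w i).Edge) → H.E}

open Classical in
/-- The transitivity coloring of a slice of a decomposition induced by the order of the DAG. -/
noncomputable def orderColoring (_ : IsDecomposition w H c part) (i : Fin n)
    (e₁ e₂ : (w i).Edge) : Option (Bool × Bool) :=
  if e₁.src = e₂.tgt ∨ e₁.tgt = e₂.src then none
  -- On the diagonal `color` would always be 00; the mark is stored there instead.
  else if e₁ = e₂ then
    some (decide (H.IsMarked (part ⟨i, e₁⟩)), decide (H.IsMarked (part ⟨i, e₁⟩)))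
  else some (H.color (part ⟨i, e₁⟩) (part ⟨i, e₂⟩))

theorem not_src_eq_tgt {S : UnitSlice T} (e : S.Edge) : ¬ (e.src = e.tgt ∨ e.tgt = e.src) := by
  have : e.src ≠ e.tgt := fun h => by
    have h' := (UnitSlice.Edge.src_eq_tgt_iff e e).1 h
    exact UnitSlice.Edge.tgt_ne_center h'.1 h'.2
  exact fun h => h.elim this fun h => this h.symm

theorem orderColoring_self (D : IsDecomposition w H c part) {i} (e : (w i).Edge) :
    (D.orderColoring i e e = some (false, false) ↔ ¬ H.IsMarked (part ⟨i, e⟩)) ∧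
    (D.orderColoring i e e = some (true, true) ↔ H.IsMarked (part ⟨i, e⟩)) := by
  rw [orderColoring, if_neg (not_src_eq_tgt e), if_pos rfl]
  simp

theorem orderColoring_of_ne (D : IsDecomposition w H c part) {i} {e₁ e₂ : (w i).Edge}
    (h : ¬ (e₁.src = e₂.tgt ∨ e₁.tgt = e₂.src)) (hne : e₁ ≠ e₂) :
    D.orderColoring i e₁ e₂ = some (H.color (part ⟨i, e₁⟩) (part ⟨i, e₂⟩)) := by
  rw [orderColoring, if_neg h, if_neg hne]

theorem orderColoring_of_tgt_center (D : IsDecomposition w H c part) {i} {e₁ e₂ : (w i).Edge}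
    (h : ∃ k, e₁.src = .inF k) (h₂ : e₂.tgt = .center) (hne : e₁ ≠ e₂) :
    D.orderColoring i e₁ e₂ = some (H.color (part ⟨i, e₁⟩) (part ⟨i, e₂⟩)) := by
  refine D.orderColoring_of_ne ?_ hne
  obtain ⟨k, hk⟩ := h
  rintro (h | h)
  · rw [hk, h₂] at h
    cases h
  · rw [eq_comm, UnitSlice.Edge.src_eq_tgt_iff] at h
    exact UnitSlice.Edge.tgt_ne_center h.1 h₂

theorem exists_src_of_tgt_center {S : UnitSlice T} {e : S.Edge} (h : e.tgt = .center) :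
    ∃ k, e.src = .inF k := by
  rcases e.src_cases with hk | hc
  · exact hk
  · exact absurd h (UnitSlice.Edge.tgt_ne_center hc)

theorem exists_tgt_of_src_center {S : UnitSlice T} {e : S.Edge} (h : e.src = .center) :
    ∃ k, e.tgt = .outF k := by
  rcases e.tgt_cases with hc | hk
  · exact absurd hc (UnitSlice.Edge.tgt_ne_center h)
  · exact hk

theorem not_le_of_src (D : IsDecomposition w H c part) {i} {e : (w i).Edge} {k}
    (hk : e.src = .inF k) : ¬ H.Le (c i) (H.src (part ⟨i, e⟩)) := by
  rintro (h | h)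
  · have := (D.src_eq_center_iff e).2 h.symm
    rw [hk] at this
    cases this
  · have h1 := D.pos_lt h
    have h2 := D.pos_src_le ⟨i, e⟩
    rw [c.symm_apply_apply] at h1
    exact absurd h1 (not_lt.2 h2)

/-- A path into the center ends with an edge entering it, and every such edge has a part in this
slice. This makes condition (v) checkable locally. -/
theorem le_center_iff (D : IsDecomposition w H c part) {i} {e : (w i).Edge} {k}
    (hk : e.src = .inF k) : H.Le (H.src (part ⟨i, e⟩)) (c i) ↔
      ∃ e' : (w i).Edge, e'.tgt = .center ∧
        H.Le (H.src (part ⟨i, e⟩)) (H.src (part ⟨i, e'⟩)) := by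
  constructor
  · rintro (h | h)
    · have := (D.src_eq_center_iff e).2 h
      rw [hk] at this
      cases this
    · obtain ⟨ε, hε, h⟩ := DAG.lt_edge_iff.1 h
      obtain ⟨e', he', rfl⟩ := D.exists_tgt_part ε hε
      exact ⟨e', he', h⟩
  · rintro ⟨e', he', h⟩
    exact Or.inr (DAG.lt_edge_iff.2 ⟨_, D.tgt_center (x := ⟨i, e'⟩) he', h⟩)

/-- The edges that can witness a mark share the target `c i`, so all of them are visible in the
slice, as condition (vi) requires. -/
theorem isMarked_iff (D : IsDecomposition w H c part) {i} {e : (w i).Edge} (he : e.tgt = .center) :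
    H.IsMarked (part ⟨i, e⟩) ↔ ∃ e' : (w i).Edge, e'.tgt = .center ∧ e ≠ e' ∧
      H.color (part ⟨i, e⟩) (part ⟨i, e'⟩) = (false, true) := by
  constructor
  · rintro ⟨ε, hε, hlt⟩
    rw [D.tgt_center (x := ⟨i, e⟩) he] at hε
    obtain ⟨e', he', rfl⟩ := D.exists_tgt_part ε hε
    refine ⟨e', he', ?_, DAG.color_eq_false_true.2 hlt⟩
    rintro rfl
    exact DAG.Lt.irrefl _ hlt
  · rintro ⟨e', he', -, h⟩
    refine ⟨part ⟨i, e'⟩, ?_, DAG.color_eq_false_true.1 h⟩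
    rw [D.tgt_center (x := ⟨i, e⟩) he, D.tgt_center (x := ⟨i, e'⟩) he']

theorem isTransitivityColoring (D : IsDecomposition w H c part) (i : Fin n) :
    IsTransitivityColoring (w i) (D.orderColoring i) where
  undefined_iff e₁ e₂ := by
    unfold orderColoring
    split_ifs with h <;> simp [h]
  antisymm e₁ e₂ a b h := by
    by_cases h0 : e₁.src = e₂.tgt ∨ e₁.tgt = e₂.src
    · rw [orderColoring, if_pos h0] at h
      cases h
    · by_cases hne : e₁ = e₂
      · subst hne
        rw [orderColoring, if_neg h0, if_pos rfl] at h ⊢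
        cases h
        rfl
      · rw [D.orderColoring_of_ne h0 hne] at h
        rw [D.orderColoring_of_ne (fun h => h0 (h.symm.imp Eq.symm Eq.symm)) (Ne.symm hne),
          DAG.color_swap (Option.some_injective _ h)]
  marking e := by
    by_cases h : H.IsMarked (part ⟨i, e⟩)
    · exact Or.inr ((D.orderColoring_self e).2.2 h)
    · exact Or.inl ((D.orderColoring_self e).1.2 h)
  same_source e₁ e₂ h hne := by
    rcases e₁.src_cases with ⟨k, hk⟩ | hc
    · exact absurd (UnitSlice.Edge.ext_of_src (h ▸ hk) hk) hne
    · have hc' : e₂.src = .center := h ▸ hc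
      rw [D.orderColoring_of_ne ?_ hne.symm, DAG.color_of_src_eq]
      · rw [D.src_center (x := ⟨i, e₁⟩) hc, D.src_center (x := ⟨i, e₂⟩) hc']
      · rintro (h | h)
        · exact UnitSlice.Edge.tgt_ne_center hc' (h ▸ hc)
        · exact UnitSlice.Edge.tgt_ne_center hc (h.trans hc')
  crossing e₁ e₂ := by
    rintro ⟨k, hk⟩ ⟨l, hl⟩ h₂
    have hne : e₁ ≠ e₂ := by
      rintro rfl
      rw [hk] at h₂
      cases h₂
    have hθ : D.orderColoring i e₁ e₂ = some (H.color (part ⟨i, e₁⟩) (part ⟨i, e₂⟩)) := by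
      refine D.orderColoring_of_ne ?_ hne
      rintro (h | h)
      · rw [UnitSlice.Edge.src_eq_tgt_iff, hk] at h
        cases h.1
      · rw [hl, h₂] at h
        cases h
    have hsrc : H.src (part ⟨i, e₂⟩) = c i := D.src_center (x := ⟨i, e₂⟩) h₂
    -- A crossing edge starts in an earlier slice, so the center is not below its source: only 01
    -- and 11 remain.
    have hnle : ¬ H.Le (H.src (part ⟨i, e₂⟩)) (H.src (part ⟨i, e₁⟩)) := hsrc ▸ D.not_le_of_src hk
    have hlt : D.orderColoring i e₁ e₂ = some (false, true) ↔
        H.Le (H.src (part ⟨i, e₁⟩)) (H.src (part ⟨i, e₂⟩)) := by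
      rw [hθ, Option.some_inj, DAG.color_eq_false_true, DAG.lt_iff_le_not_le]
      exact and_iff_left hnle
    constructor
    · by_cases h : H.Le (H.src (part ⟨i, e₁⟩)) (H.src (part ⟨i, e₂⟩))
      · exact Or.inl (hlt.2 h)
      · exact Or.inr (by rw [hθ, DAG.color_eq_true_true h hnle])
    · rw [hlt, hsrc, D.le_center_iff hk]
      refine exists_congr fun e => and_congr_right fun he => ?_
      have hne' : e₁ ≠ e := by
        rintro rfl
        rw [hl] at he
        cases he
      rw [D.orderColoring_of_tgt_center ⟨k, hk⟩ he hne', Option.some_inj, Option.some_inj,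
        DAG.color_eq_false]
  marked_iff e he := by
    rw [(D.orderColoring_self e).2, D.isMarked_iff he]
    refine exists_congr fun e' => and_congr_right fun he' => ?_
    -- Diagonal values are 00 or 11, so `e' = e` never witnesses the mark.
    by_cases hne : e = e'
    · subst hne
      have hself := D.orderColoring_self e
      by_cases hm : H.IsMarked (part ⟨i, e⟩)
      · simp [hself.2.2 hm]
      · simp [hself.1.2 hm]
    · rw [D.orderColoring_of_tgt_center (exists_src_of_tgt_center he) he' hne, Option.some_inj]
      exact and_iff_right hne

/-- The endpoints of the edges touching the in-frontier. -/
noncomputable def inEnds (_ : IsDecomposition w H c part) (i : Fin n) (k : Fin (w i).inn) :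
    H.V × H.V :=
  (H.src (part ⟨i, (w i).inEdge k⟩), H.tgt (part ⟨i, (w i).inEdge k⟩))

/-- The endpoints of the edges touching the out-frontier. -/
noncomputable def outEnds (_ : IsDecomposition w H c part) (i : Fin n) (k : Fin (w i).out) :
    H.V × H.V :=
  (H.src (part ⟨i, (w i).outEdge k⟩), H.tgt (part ⟨i, (w i).outEdge k⟩))

theorem sameInCell_iff (D : IsDecomposition w H c part) {i} {e₁ e₂ : (w i).Edge} :
    SameInCell (.ofFun (D.inEnds i)) e₁ e₂ ↔
      (∃ k, e₁.src = .inF k) ∧ H.Parallel (part ⟨i, e₁⟩) (part ⟨i, e₂⟩) := by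
  constructor
  · rintro ⟨k, l, hk, hl, h⟩
    rw [NumberedPartition.ofFun_cell_eq_iff, inEnds, inEnds, ← UnitSlice.eq_inEdge hk,
      ← UnitSlice.eq_inEdge hl, Prod.mk.injEq] at h
    exact ⟨⟨k, hk⟩, h⟩
  · rintro ⟨⟨k, hk⟩, h⟩
    obtain ⟨l, hl⟩ : ∃ l, e₂.src = .inF l := by
      rcases e₂.src_cases with hl | hc
      · exact hl
      · rw [D.src_eq_center_iff, ← h.1, ← D.src_eq_center_iff, hk] at hc
        cases hc
    refine ⟨k, l, hk, hl, ?_⟩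
    rwa [NumberedPartition.ofFun_cell_eq_iff, inEnds, inEnds, ← UnitSlice.eq_inEdge hk,
      ← UnitSlice.eq_inEdge hl, Prod.mk.injEq]

theorem sameOutCell_iff (D : IsDecomposition w H c part) {i} {e₁ e₂ : (w i).Edge} :
    SameOutCell (.ofFun (D.outEnds i)) e₁ e₂ ↔
      (∃ k, e₁.tgt = .outF k) ∧ H.Parallel (part ⟨i, e₁⟩) (part ⟨i, e₂⟩) := by
  constructor
  · rintro ⟨k, l, hk, hl, h⟩
    rw [NumberedPartition.ofFun_cell_eq_iff, outEnds, outEnds, ← UnitSlice.eq_outEdge hk,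
      ← UnitSlice.eq_outEdge hl, Prod.mk.injEq] at h
    exact ⟨⟨k, hk⟩, h⟩
  · rintro ⟨⟨k, hk⟩, h⟩
    obtain ⟨l, hl⟩ : ∃ l, e₂.tgt = .outF l := by
      rcases e₂.tgt_cases with hc | hl
      · rw [D.tgt_eq_center_iff, ← h.2, ← D.tgt_eq_center_iff, hk] at hc
        cases hc
      · exact hl
    refine ⟨k, l, hk, hl, ?_⟩
    rwa [NumberedPartition.ofFun_cell_eq_iff, outEnds, outEnds, ← UnitSlice.eq_outEdge hk,
      ← UnitSlice.eq_outEdge hl, Prod.mk.injEq]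

theorem parallel_of_sameCell (D : IsDecomposition w H c part) {i} {e₁ e₂ : (w i).Edge}
    (h : SameInCell (.ofFun (D.inEnds i)) e₁ e₂ ∨ SameOutCell (.ofFun (D.outEnds i)) e₁ e₂) :
    H.Parallel (part ⟨i, e₁⟩) (part ⟨i, e₂⟩) :=
  h.elim (fun h => (D.sameInCell_iff.1 h).2) fun h => (D.sameOutCell_iff.1 h).2

/-- The multi-edge transitivity coloring of a slice of a decomposition induced by the DAG. -/
noncomputable def multiEdgeColoring (D : IsDecomposition w H c part) (i : Fin n) :
    MultiEdgeColoring (w i) where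
  θ := D.orderColoring i
  Pin := .ofFun (D.inEnds i)
  Pout := .ofFun (D.outEnds i)
  coloring := D.isTransitivityColoring i
  in_cell e₁ e₂ h := by
    rw [D.sameInCell_iff] at h
    rcases e₁.tgt_cases with hc | hk
    · refine Or.inl ⟨hc, ?_⟩
      rwa [D.tgt_eq_center_iff, ← h.2.2, ← D.tgt_eq_center_iff]
    · exact Or.inr (D.sameOutCell_iff.2 ⟨hk, h.2⟩)
  out_cell e₁ e₂ h := by
    rw [D.sameOutCell_iff] at h
    rcases e₁.src_cases with hk | hc
    · exact Or.inr (D.sameInCell_iff.2 ⟨hk, h.2⟩)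
    · refine Or.inl ⟨hc, ?_⟩
      rwa [D.src_eq_center_iff, ← h.2.1, ← D.src_eq_center_iff]
  same_color e e₁ e₂ _ h₁ h₂ h := by
    have hp := D.parallel_of_sameCell h
    -- Undefinedness depends only on which edges start or end at the center, and parallel edges do
    -- so together.
    have hundef : (e.src = e₁.tgt ∨ e.tgt = e₁.src) ↔ (e.src = e₂.tgt ∨ e.tgt = e₂.src) := by
      rw [UnitSlice.Edge.src_eq_tgt_iff, UnitSlice.Edge.src_eq_tgt_iff, @eq_comm _ e.tgt,
        @eq_comm _ e.tgt, UnitSlice.Edge.src_eq_tgt_iff, UnitSlice.Edge.src_eq_tgt_iff,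
        D.tgt_eq_center_iff e₁, D.tgt_eq_center_iff e₂, D.src_eq_center_iff e₁,
        D.src_eq_center_iff e₂, hp.1, hp.2]
    by_cases h0 : e.src = e₁.tgt ∨ e.tgt = e₁.src
    · rw [orderColoring, orderColoring, if_pos h0, if_pos (hundef.1 h0)]
    · rw [D.orderColoring_of_ne h0 h₁, D.orderColoring_of_ne (fun h => h0 (hundef.2 h)) h₂,
        hp.color_eq]
  same_marking e₁ e₂ h := by
    rw [(D.orderColoring_self e₁).2, (D.orderColoring_self e₂).2,
      (D.parallel_of_sameCell h).isMarked_iff]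
  same_target e₁ e₂ h₁ h₂ h := by
    refine D.sameInCell_iff.2 ⟨exists_src_of_tgt_center h₁, ?_⟩
    by_cases hne : e₁ = e₂
    · subst hne
      exact ⟨rfl, rfl⟩
    · rw [D.orderColoring_of_tgt_center (exists_src_of_tgt_center h₁) h₂ hne, Option.some_inj,
        DAG.color_eq_false_false] at h
      exact ⟨h, (D.tgt_center (x := ⟨i, e₁⟩) h₁).trans (D.tgt_center (x := ⟨i, e₂⟩) h₂).symm⟩

/-- Colors, marks and cells are functions of the edges of `H`, and glued parts belong to the same
edge. -/
theorem coloringsAgree (D : IsDecomposition w H c part) {i j : Fin n} (hij : i.val + 1 = j.val) :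
    ColoringsAgree (D.multiEdgeColoring i) (D.multiEdgeColoring j) := by
  have hpart : ∀ {e : (w i).Edge} {e' : (w j).Edge} {k l}, e.tgt = .outF k → e'.src = .inF l →
      k.val = l.val → part ⟨i, e⟩ = part ⟨j, e'⟩ :=
    fun hk hl h => D.glued ⟨hij, _, _, hk, hl, h⟩
  constructor
  · intro e₁ e₂ e₁' e₂' j₁ j₂ i₁ i₂ h₁ h₂ h₁' h₂' h h'
    have h0 : ¬ (e₁.src = e₂.tgt ∨ e₁.tgt = e₂.src) := by
      rw [@eq_comm _ e₁.tgt, UnitSlice.Edge.src_eq_tgt_iff, UnitSlice.Edge.src_eq_tgt_iff, h₁, h₂]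
      simp
    have h0' : ¬ (e₁'.src = e₂'.tgt ∨ e₁'.tgt = e₂'.src) := by
      rw [@eq_comm _ e₁'.tgt, UnitSlice.Edge.src_eq_tgt_iff, UnitSlice.Edge.src_eq_tgt_iff, h₁',
        h₂']
      simp
    have hp₁ := hpart h₁ h₁' h
    have hp₂ := hpart h₂ h₂' h'
    show D.orderColoring i e₁ e₂ = D.orderColoring j e₁' e₂'
    by_cases hne : e₁ = e₂
    · subst hne
      obtain rfl : e₁' = e₂' := D.inj (hp₁.symm.trans hp₂)
      rw [orderColoring, if_neg h0, if_pos rfl, orderColoring, if_neg h0', if_pos rfl, hp₁]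
    · have hne' : e₁' ≠ e₂' := by
        rintro rfl
        exact hne (D.inj (hp₁.trans hp₂.symm))
      rw [D.orderColoring_of_ne h0 hne, D.orderColoring_of_ne h0' hne', hp₁, hp₂]
  · intro k l h
    refine NumberedPartition.ofFun_cell_congr (D.word.2.2 i j hij) (fun k l h => ?_) h
    rw [outEnds, inEnds, hpart (UnitSlice.outEdge_tgt _ k) (UnitSlice.inEdge_src _ l) h]

end IsDecomposition

/-! ### Rigidity of coherent colorings -/

namespace ColoringsAgree

variable {T : Type u} {n : ℕ} {w : Fin n → UnitSlice T} {M : ∀ i, MultiEdgeColoring (w i)}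
  {i j : Fin n} {e₁ e₂ : (w i).Edge} {f₁ f₂ : (w j).Edge}

theorem color_eq (h : ColoringsAgree (M i) (M j)) (h₁ : Glued w ⟨i, e₁⟩ ⟨j, f₁⟩)
    (h₂ : Glued w ⟨i, e₂⟩ ⟨j, f₂⟩) : (M i).θ e₁ e₂ = (M j).θ f₁ f₂ := by
  obtain ⟨-, k₁, l₁, hk₁, hl₁, h₁⟩ := h₁
  obtain ⟨-, k₂, l₂, hk₂, hl₂, h₂⟩ := h₂
  exact h.1 e₁ e₂ f₁ f₂ k₁ k₂ l₁ l₂ hk₁ hk₂ hl₁ hl₂ h₁ h₂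

theorem sameCell_iff (h : ColoringsAgree (M i) (M j)) (h₁ : Glued w ⟨i, e₁⟩ ⟨j, f₁⟩)
    (h₂ : Glued w ⟨i, e₂⟩ ⟨j, f₂⟩) :
    SameOutCell (M i).Pout e₁ e₂ ↔ SameInCell (M j).Pin f₁ f₂ := by
  obtain ⟨-, k₁, l₁, hk₁, hl₁, h₁⟩ := h₁
  obtain ⟨-, k₂, l₂, hk₂, hl₂, h₂⟩ := h₂
  simp only at hk₁ hk₂ hl₁ hl₂
  simp only [SameOutCell, SameInCell, hk₁, hk₂, hl₁, hl₂, SliceVertex.outF.injEq,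
    SliceVertex.inF.injEq]
  have e1 := h.2 _ _ h₁
  have e2 := h.2 _ _ h₂
  constructor
  · rintro ⟨a, b, rfl, rfl, hab⟩
    exact ⟨l₁, l₂, rfl, rfl, e1.symm.trans (hab.trans e2)⟩
  · rintro ⟨a, b, rfl, rfl, hab⟩
    exact ⟨k₁, k₂, rfl, rfl, e1.trans (hab.trans e2.symm)⟩

end ColoringsAgree

namespace IsDecomposition

variable {T : Type u} {n : ℕ} {w : Fin n → UnitSlice T} {H : DAG T}
  {c : Fin n ≃ H.V} {part : (Σ i, (w i).Edge) → H.E} {M : ∀ i, MultiEdgeColoring (w i)}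

theorem exists_prev (D : IsDecomposition w H c part) {j : Fin n} {f₁ f₂ : (w j).Edge}
    (h₁ : ∃ k, f₁.src = .inF k) (h₂ : ∃ k, f₂.src = .inF k) :
    ∃ (i : Fin n) (e₁ e₂ : (w i).Edge), i.val + 1 = j.val ∧
      Glued w ⟨i, e₁⟩ ⟨j, f₁⟩ ∧ Glued w ⟨i, e₂⟩ ⟨j, f₂⟩ := by
  obtain ⟨k₁, hk₁⟩ := h₁
  obtain ⟨k₂, hk₂⟩ := h₂
  obtain ⟨⟨i, e₁⟩, h₁⟩ := D.word.exists_prev hk₁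
  obtain ⟨⟨i', e₂⟩, h₂⟩ := D.word.exists_prev hk₂
  obtain rfl : i = i' := Fin.ext (Nat.add_right_cancel (h₁.1.trans h₂.1.symm))
  exact ⟨i, e₁, e₂, h₁.1, h₁, h₂⟩

theorem exists_next (D : IsDecomposition w H c part) {i : Fin n} {e₁ e₂ : (w i).Edge}
    (h₁ : ∃ k, e₁.tgt = .outF k) (h₂ : ∃ k, e₂.tgt = .outF k) :
    ∃ (j : Fin n) (f₁ f₂ : (w j).Edge), i.val + 1 = j.val ∧
      Glued w ⟨i, e₁⟩ ⟨j, f₁⟩ ∧ Glued w ⟨i, e₂⟩ ⟨j, f₂⟩ := by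
  obtain ⟨k₁, hk₁⟩ := h₁
  obtain ⟨k₂, hk₂⟩ := h₂
  obtain ⟨⟨j, f₁⟩, h₁⟩ := D.word.exists_next hk₁
  obtain ⟨⟨j', f₂⟩, h₂⟩ := D.word.exists_next hk₂
  obtain rfl : j = j' := Fin.ext (h₁.1.symm.trans h₂.1)
  exact ⟨j, f₁, f₂, h₁.1, h₁, h₂⟩

/-- By (v) the value is decided by the comparisons of `e₁` with the edges entering the center. These
are pairs on the in-frontier, correct by `hin`, and `le_center_iff` says that the order of `H` obeys
the same rule. -/
theorem color_crossing (D : IsDecomposition w H c part) {i : Fin n}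
    (hin : ∀ e₁ e₂ : (w i).Edge, (∃ k, e₁.src = .inF k) → (∃ k, e₂.src = .inF k) → e₁ ≠ e₂ →
      (M i).θ e₁ e₂ = some (H.color (part ⟨i, e₁⟩) (part ⟨i, e₂⟩)))
    {e₁ e₂ : (w i).Edge} (h₁ : ∃ k, e₁.src = .inF k) (h₁' : ∃ k, e₁.tgt = .outF k)
    (h₂ : e₂.src = .center) :
    (M i).θ e₁ e₂ = some (H.color (part ⟨i, e₁⟩) (part ⟨i, e₂⟩)) := by
  obtain ⟨hor, hiff⟩ := (M i).coloring.crossing e₁ e₂ h₁ h₁' h₂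
  obtain ⟨k, hk⟩ := h₁
  have hsrc : H.src (part ⟨i, e₂⟩) = c i := D.src_center (x := ⟨i, e₂⟩) h₂
  have hnle : ¬ H.Le (H.src (part ⟨i, e₂⟩)) (H.src (part ⟨i, e₁⟩)) := hsrc ▸ D.not_le_of_src hk
  have hle : (M i).θ e₁ e₂ = some (false, true) ↔
      H.Le (H.src (part ⟨i, e₁⟩)) (H.src (part ⟨i, e₂⟩)) := by
    rw [hiff, hsrc, D.le_center_iff hk]
    refine exists_congr fun e => and_congr_right fun he => ?_
    have hne : e₁ ≠ e := by
      rintro rfl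
      obtain ⟨l, hl⟩ := h₁'
      rw [hl] at he
      cases he
    rw [hin e₁ e ⟨k, hk⟩ (exists_src_of_tgt_center he) hne, Option.some_inj, Option.some_inj,
      DAG.color_eq_false]
  by_cases h : H.Le (H.src (part ⟨i, e₁⟩)) (H.src (part ⟨i, e₂⟩))
  · rw [hle.2 h, DAG.color_eq_false_true.2 (DAG.lt_iff_le_not_le.2 ⟨h, hnle⟩)]
  · rw [DAG.color_eq_true_true h hnle]
    exact hor.resolve_left fun h' => h (hle.1 h')

/-- Coherent transitivity colorings reflect the order of the DAG. -/
theorem color_eq (D : IsDecomposition w H c part)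
    (hM : ∀ i j : Fin n, i.val + 1 = j.val → ColoringsAgree (M i) (M j)) (i : Fin n)
    (e₁ e₂ : (w i).Edge) (h : ¬ (e₁.src = e₂.tgt ∨ e₁.tgt = e₂.src)) (hne : e₁ ≠ e₂) :
    (M i).θ e₁ e₂ = some (H.color (part ⟨i, e₁⟩) (part ⟨i, e₂⟩)) := by
  obtain ⟨m, hm⟩ : ∃ m, i.val = m := ⟨_, rfl⟩
  induction m using Nat.strong_induction_on generalizing i with
  | _ m ih =>
    -- Pairs on the in-frontier inherit their color from the previous slice; the remaining pairs
    -- involve an edge leaving the center.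
    have hin : ∀ e₁ e₂ : (w i).Edge, (∃ k, e₁.src = .inF k) → (∃ k, e₂.src = .inF k) → e₁ ≠ e₂ →
        (M i).θ e₁ e₂ = some (H.color (part ⟨i, e₁⟩) (part ⟨i, e₂⟩)) := by
      intro e₁ e₂ h₁ h₂ hne
      obtain ⟨j, f₁, f₂, hj, hg₁, hg₂⟩ := D.exists_prev h₁ h₂
      rw [← (hM j i hj).color_eq hg₁ hg₂, ← D.glued hg₁, ← D.glued hg₂]
      refine ih j.val (by omega) j f₁ f₂ ?_ ?_ rfl
      · rw [@eq_comm _ f₁.tgt, UnitSlice.Edge.src_eq_tgt_iff, UnitSlice.Edge.src_eq_tgt_iff]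
        exact fun h => h.elim (fun h => hg₂.tgt_ne_center h.2) fun h => hg₁.tgt_ne_center h.2
      · rintro rfl
        exact hne (D.inj ((D.glued hg₁).symm.trans (D.glued hg₂)))
    rw [@eq_comm _ e₁.tgt, UnitSlice.Edge.src_eq_tgt_iff, UnitSlice.Edge.src_eq_tgt_iff] at h
    push Not at h
    rcases e₁.src_cases with h₁ | h₁ <;> rcases e₂.src_cases with h₂ | h₂
    · exact hin e₁ e₂ h₁ h₂ hne
    · exact D.color_crossing hin h₁ (e₁.tgt_cases.resolve_left (h.2 h₂)) h₂
    · have := D.color_crossing hin h₂ (e₂.tgt_cases.resolve_left (h.1 h₁)) h₁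
      rw [(M i).coloring.antisymm _ _ _ _ this]
      rfl
    · rw [(M i).coloring.same_source e₁ e₂ (h₁.trans h₂.symm) hne.symm, DAG.color_of_src_eq]
      rw [D.src_center (x := ⟨i, e₁⟩) h₁, D.src_center (x := ⟨i, e₂⟩) h₂]

theorem color_eq_of_tgt_center (D : IsDecomposition w H c part)
    (hM : ∀ i j : Fin n, i.val + 1 = j.val → ColoringsAgree (M i) (M j)) {i : Fin n}
    {e₁ e₂ : (w i).Edge} (h₁ : e₁.tgt = .center) (h₂ : e₂.tgt = .center) (hne : e₁ ≠ e₂) :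
    (M i).θ e₁ e₂ = some (H.color (part ⟨i, e₁⟩) (part ⟨i, e₂⟩)) := by
  refine D.color_eq hM i e₁ e₂ ?_ hne
  rw [@eq_comm _ e₁.tgt, UnitSlice.Edge.src_eq_tgt_iff, UnitSlice.Edge.src_eq_tgt_iff]
  exact fun h => h.elim (fun h => UnitSlice.Edge.tgt_ne_center h.1 h₁)
    fun h => UnitSlice.Edge.tgt_ne_center h.1 h₂

/-- Coherent transitivity colorings mark exactly the edges implied by transitivity. -/
theorem marked_iff (D : IsDecomposition w H c part)
    (hM : ∀ i j : Fin n, i.val + 1 = j.val → ColoringsAgree (M i) (M j)) {i : Fin n}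
    (e : (w i).Edge) : (M i).θ e e = some (true, true) ↔ H.IsMarked (part ⟨i, e⟩) := by
  -- The mark is decided by (vi) in the slice of the target and carried back to earlier parts by
  -- agreement.
  refine D.word.induction_tgt
    (P := fun x => (M x.1).θ x.2 x.2 = some (true, true) ↔ H.IsMarked (part x)) ?_ ?_ ⟨i, e⟩
  · rintro ⟨i, e⟩ he
    simp only at he ⊢
    rw [(M i).coloring.marked_iff e he, D.isMarked_iff he]
    refine exists_congr fun e' => and_congr_right fun he' => ?_
    by_cases hne : e = e'
    · subst hne
      rcases (M i).coloring.marking e with h | h <;> simp [h]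
    · rw [D.color_eq_of_tgt_center hM he he' hne, Option.some_inj]
      exact (and_iff_right hne).symm
  · rintro ⟨i, e⟩ ⟨j, f⟩ h ih
    rw [D.glued h, ← ih]
    simp only
    rw [(hM i j h.1).color_eq h h]

theorem unmarked_iff (D : IsDecomposition w H c part)
    (hM : ∀ i j : Fin n, i.val + 1 = j.val → ColoringsAgree (M i) (M j)) {i : Fin n}
    (e : (w i).Edge) : (M i).θ e e = some (false, false) ↔ ¬ H.IsMarked (part ⟨i, e⟩) := by
  rw [(M i).not_marked_iff, D.marked_iff hM]

/-- By (a), edges sharing a cell continue to share one in the following slices until both end at the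
same center. -/
theorem tgt_eq_of_sameCell (D : IsDecomposition w H c part)
    (hM : ∀ i j : Fin n, i.val + 1 = j.val → ColoringsAgree (M i) (M j)) {i : Fin n}
    {e₁ e₂ : (w i).Edge} (h : SameInCell (M i).Pin e₁ e₂ ∨ SameOutCell (M i).Pout e₁ e₂) :
    H.tgt (part ⟨i, e₁⟩) = H.tgt (part ⟨i, e₂⟩) := by
  refine D.word.induction_tgt (P := fun x => ∀ e₂ : (w x.1).Edge,
    (SameInCell (M x.1).Pin x.2 e₂ ∨ SameOutCell (M x.1).Pout x.2 e₂) →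
    H.tgt (part x) = H.tgt (part ⟨x.1, e₂⟩)) ?_ ?_ ⟨i, e₁⟩ e₂ h
  · rintro ⟨i, e₁⟩ h₁ e₂ h
    simp only at h₁ h ⊢
    have h₂ : e₂.tgt = .center := by
      rcases h.imp_left ((M i).in_cell e₁ e₂) with (h | ⟨k, l, hk, -⟩) | ⟨k, l, hk, -⟩
      · exact h.2
      · rw [hk] at h₁
        cases h₁
      · rw [hk] at h₁
        cases h₁
    rw [D.tgt_center (x := ⟨i, e₁⟩) h₁, D.tgt_center (x := ⟨i, e₂⟩) h₂]
  · rintro ⟨i, e₁⟩ ⟨j, f₁⟩ hg ih e₂ h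
    simp only at h ih ⊢
    have h' : SameOutCell (M i).Pout e₁ e₂ := by
      rcases h.imp_left ((M i).in_cell e₁ e₂) with (h | h) | h
      · exact absurd h.1 hg.tgt_ne_center
      · exact h
      · exact h
    obtain ⟨k, l, hk, hl, -⟩ := id h'
    obtain ⟨j', f₁', f₂, -, hg₁, hg₂⟩ := D.exists_next ⟨k, hk⟩ ⟨l, hl⟩
    obtain rfl : j' = j := Fin.ext (hg₁.1.symm.trans hg.1)
    rw [D.glued hg, D.glued hg₂]
    exact ih f₂ (Or.inl (((hM i j' hg.1).sameCell_iff hg hg₂).1 h'))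

/-- The mirror image: cell mates are followed to the left until both start at the same center. -/
theorem src_eq_of_sameCell (D : IsDecomposition w H c part)
    (hM : ∀ i j : Fin n, i.val + 1 = j.val → ColoringsAgree (M i) (M j)) {i : Fin n}
    {e₁ e₂ : (w i).Edge} (h : SameInCell (M i).Pin e₁ e₂ ∨ SameOutCell (M i).Pout e₁ e₂) :
    H.src (part ⟨i, e₁⟩) = H.src (part ⟨i, e₂⟩) := by
  refine D.word.induction_src (P := fun x => ∀ e₂ : (w x.1).Edge,
    (SameInCell (M x.1).Pin x.2 e₂ ∨ SameOutCell (M x.1).Pout x.2 e₂) →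
    H.src (part x) = H.src (part ⟨x.1, e₂⟩)) ?_ ?_ ⟨i, e₁⟩ e₂ h
  · rintro ⟨i, e₁⟩ h₁ e₂ h
    simp only at h₁ h ⊢
    have h₂ : e₂.src = .center := by
      rcases h.symm.imp_left ((M i).out_cell e₁ e₂) with (h | ⟨k, l, hk, -⟩) | ⟨k, l, hk, -⟩
      · exact h.2
      · rw [hk] at h₁
        cases h₁
      · rw [hk] at h₁
        cases h₁
    rw [D.src_center (x := ⟨i, e₁⟩) h₁, D.src_center (x := ⟨i, e₂⟩) h₂]
  · rintro ⟨j, f₁⟩ ⟨i, e₁⟩ hg ih e₂ h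
    simp only at h ih ⊢
    have h' : SameInCell (M i).Pin e₁ e₂ := by
      rcases h.symm.imp_left ((M i).out_cell e₁ e₂) with (h | h) | h
      · exact absurd h.1 hg.src_ne_center
      · exact h
      · exact h
    obtain ⟨k, l, hk, hl, -⟩ := id h'
    obtain ⟨j', f₁', f₂, -, hg₁, hg₂⟩ := D.exists_prev ⟨k, hk⟩ ⟨l, hl⟩
    obtain rfl : j' = j := Fin.ext (Nat.add_right_cancel (hg₁.1.trans hg.1.symm))
    rw [← D.glued hg, ← D.glued hg₂]
    exact ih f₂ (Or.inr (((hM j' i hg.1).sameCell_iff hg hg₂).2 h'))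

/-- At the common target, equal sources give color 00, and (d) puts the edges in one cell. Agreement
and (a) then carry this back to all earlier parts. -/
theorem sameCell_of_parallel (D : IsDecomposition w H c part)
    (hM : ∀ i j : Fin n, i.val + 1 = j.val → ColoringsAgree (M i) (M j)) {i : Fin n}
    {e₁ e₂ : (w i).Edge} (h : H.Parallel (part ⟨i, e₁⟩) (part ⟨i, e₂⟩)) :
    ((∃ k, e₁.src = .inF k) → SameInCell (M i).Pin e₁ e₂) ∧
    ((∃ k, e₁.tgt = .outF k) → SameOutCell (M i).Pout e₁ e₂) := by
  refine D.word.induction_tgt (P := fun x => ∀ e₂ : (w x.1).Edge,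
    H.Parallel (part x) (part ⟨x.1, e₂⟩) →
    ((∃ k, x.2.src = .inF k) → SameInCell (M x.1).Pin x.2 e₂) ∧
    ((∃ k, x.2.tgt = .outF k) → SameOutCell (M x.1).Pout x.2 e₂)) ?_ ?_ ⟨i, e₁⟩ e₂ h
  · rintro ⟨i, e₁⟩ h₁ e₂ h
    simp only at h₁ h ⊢
    refine ⟨fun _ => ?_, fun ⟨k, hk⟩ => by rw [hk] at h₁; cases h₁⟩
    have h₂ : e₂.tgt = .center := by rwa [D.tgt_eq_center_iff, ← h.2, ← D.tgt_eq_center_iff]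
    by_cases hne : e₁ = e₂
    · subst hne
      obtain ⟨k, hk⟩ := exists_src_of_tgt_center h₁
      exact ⟨k, k, hk, hk, rfl⟩
    · exact (M i).same_target e₁ e₂ h₁ h₂ (by
        rw [D.color_eq_of_tgt_center hM h₁ h₂ hne, DAG.color_of_src_eq h.1])
  · rintro ⟨i, e₁⟩ ⟨j, f₁⟩ hg ih e₂ h
    simp only at h ih ⊢
    have h₁ := e₁.tgt_cases.resolve_left hg.tgt_ne_center
    have h₂ := e₂.tgt_cases.resolve_left (by
      rw [D.tgt_eq_center_iff, ← h.2, ← D.tgt_eq_center_iff]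
      exact hg.tgt_ne_center)
    have hout : SameOutCell (M i).Pout e₁ e₂ := by
      obtain ⟨j', f₁', f₂, -, hg₁, hg₂⟩ := D.exists_next h₁ h₂
      obtain rfl : j' = j := Fin.ext (hg₁.1.symm.trans hg.1)
      rw [(hM i j' hg.1).sameCell_iff hg hg₂]
      rw [D.glued hg, D.glued hg₂] at h
      obtain ⟨-, k, l, -, hl, -⟩ := hg
      exact (ih f₂ h).1 ⟨l, hl⟩
    refine ⟨fun ⟨k, hk⟩ => ((M i).out_cell e₁ e₂ hout).resolve_left fun h => ?_, fun _ => hout⟩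
    rw [hk] at h
    cases h.1

theorem parallel_of_sameCell_of_agree (D : IsDecomposition w H c part)
    (hM : ∀ i j : Fin n, i.val + 1 = j.val → ColoringsAgree (M i) (M j)) {i : Fin n}
    {e₁ e₂ : (w i).Edge} (h : SameInCell (M i).Pin e₁ e₂ ∨ SameOutCell (M i).Pout e₁ e₂) :
    H.Parallel (part ⟨i, e₁⟩) (part ⟨i, e₂⟩) :=
  ⟨D.src_eq_of_sameCell hM h, D.tgt_eq_of_sameCell hM h⟩

end IsDecomposition

/-! ### The transitive reduction and its decompositions -/

namespace DAG

variable {T : Type u}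

/-- The transitive reduction of a DAG: the edges implied by transitivity are deleted, and multiple
edges are collapsed. -/
abbrev reduct (H : DAG T) : DAG T where
  V := H.V
  E := {p : H.V × H.V // ∃ ε, ¬ H.IsMarked ε ∧ H.src ε = p.1 ∧ H.tgt ε = p.2}
  src p := p.1.1
  tgt p := p.1.2
  label := H.label
  acyclic x h := H.acyclic x (h.lift id fun _ _ ⟨⟨_, ε, _, hs, ht⟩, h, h'⟩ =>
    ⟨ε, hs.trans h, ht.trans h'⟩)

variable {H : DAG T}

theorem lt_edge_iff' {a b : H.V} : H.Lt a b ↔ ∃ ε, H.src ε = a ∧ H.Le (H.tgt ε) b := by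
  constructor
  · intro h
    rcases Relation.TransGen.head'_iff.1 h with ⟨d, ⟨ε, hs, rfl⟩, h⟩
    exact ⟨ε, hs, (Relation.reflTransGen_iff_eq_or_transGen.1 h).imp_left Eq.symm⟩
  · rintro ⟨ε, rfl, h | h⟩
    · rw [← h]
      exact Lt.edge ε
    · exact (Lt.edge ε).trans h

end DAG

namespace IsDecomposition

variable {T : Type u} {n : ℕ} {w : Fin n → UnitSlice T} {H : DAG T}
  {c : Fin n ≃ H.V} {part : (Σ i, (w i).Edge) → H.E} {M : ∀ i, MultiEdgeColoring (w i)}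

/-- The transitive reduction induces the same partial order. -/
theorem reduct_lt (D : IsDecomposition w H c part) {a b : H.V} (h : H.Lt a b) :
    H.reduct.Lt a b := by
  -- Induction on the distance of positions: any intermediate vertex splits the relation into two
  -- shorter ones, and a marked edge supplies such a vertex.
  obtain ⟨m, hm⟩ : ∃ m, (c.symm b).val - (c.symm a).val = m := ⟨_, rfl⟩
  induction m using Nat.strong_induction_on generalizing a b with
  | _ m ih =>
    have split : ∀ d : H.V, H.Lt a d → H.Lt d b → H.reduct.Lt a b := by
      intro d h₁ h₂
      have h₁' : (c.symm a).val < (c.symm d).val := D.pos_lt h₁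
      have h₂' : (c.symm d).val < (c.symm b).val := D.pos_lt h₂
      exact (ih _ (by omega) h₁ rfl).trans (ih _ (by omega) h₂ rfl)
    obtain ⟨ε, rfl, rfl | hle⟩ := DAG.lt_edge_iff.1 h
    · by_cases hmark : H.IsMarked ε
      · obtain ⟨ε', ht, hlt⟩ := hmark
        exact split _ hlt (ht ▸ DAG.Lt.edge ε')
      · exact .single ⟨⟨(H.src ε, H.tgt ε), ε, hmark, rfl, rfl⟩, rfl, rfl⟩
    · exact split _ hle (DAG.Lt.edge ε)

theorem collapses_src (M : ∀ i, MultiEdgeColoring (w i)) {i} {e : (w i).Edge}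
    (hm : (M i).θ e e = some (false, false)) : ∃ a, (M i).Collapses e.src a := by
  rcases e.src_cases with ⟨k, hk⟩ | hk
  · obtain ⟨p, hp⟩ := (M i).exists_inF_eq ((M i).mem_unmarkedIn hk hm)
    exact ⟨.inF p, by rw [hk]; exact hp.symm⟩
  · exact ⟨.center, by rw [hk]; trivial⟩

theorem collapses_tgt (M : ∀ i, MultiEdgeColoring (w i)) {i} {e : (w i).Edge}
    (hm : (M i).θ e e = some (false, false)) : ∃ b, (M i).Collapses e.tgt b := by
  rcases e.tgt_cases with hk | ⟨k, hk⟩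
  · exact ⟨.center, by rw [hk]; trivial⟩
  · obtain ⟨p, hp⟩ := (M i).exists_outF_eq ((M i).mem_unmarkedOut hk hm)
    exact ⟨.outF p, by rw [hk]; exact hp.symm⟩

end IsDecomposition

namespace MultiEdgeColoring

variable {T : Type u} {S : UnitSlice T} {M : MultiEdgeColoring S}

theorem Collapses.of_inF {x} {p} (h : M.Collapses x (.inF p)) :
    ∃ k, x = .inF k ∧ M.Pin.cell k = M.unmarkedIn.orderEmbOfFin rfl p := by
  cases x with
  | inF k => exact ⟨k, rfl, h⟩
  | center => exact h.elim
  | outF k => exact h.elim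

theorem Collapses.of_outF {x} {p} (h : M.Collapses x (.outF p)) :
    ∃ k, x = .outF k ∧ M.Pout.cell k = M.unmarkedOut.orderEmbOfFin rfl p := by
  cases x with
  | inF k => exact h.elim
  | center => exact h.elim
  | outF k => exact ⟨k, rfl, h⟩

theorem Collapses.of_center {x} (h : M.Collapses x .center) : x = .center := by
  cases x with
  | inF k => exact h.elim
  | center => rfl
  | outF k => exact h.elim

theorem Collapses.eq_of_inF {k l : Fin S.inn} {a b} (h : M.Collapses (.inF k) a)
    (h' : M.Collapses (.inF l) b) (hkl : M.Pin.cell k = M.Pin.cell l) : a = b := by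
  cases a <;> cases b <;> simp only [Collapses] at h h'
  rw [h, h'] at hkl
  simpa using hkl

theorem Collapses.eq_of_outF {k l : Fin S.out} {a b} (h : M.Collapses (.outF k) a)
    (h' : M.Collapses (.outF l) b) (hkl : M.Pout.cell k = M.Pout.cell l) : a = b := by
  cases a <;> cases b <;> simp only [Collapses] at h h'
  rw [h, h'] at hkl
  simpa using hkl

theorem Collapses.eq_center {a} (h : M.Collapses .center a) : a = .center := by
  cases a with
  | inF k => exact h.elim
  | center => rfl
  | outF k => exact h.elim

end MultiEdgeColoring

namespace IsDecomposition

variable {T : Type u} {n : ℕ} {w : Fin n → UnitSlice T} {H : DAG T}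
  {c : Fin n ≃ H.V} {part : (Σ i, (w i).Edge) → H.E} {M : ∀ i, MultiEdgeColoring (w i)}

/-- A reduced edge touches a frontier on at least one side, and the cell there already fixes the
parallel class of its preimages. -/
theorem parallel_of_collapses (D : IsDecomposition w H c part)
    (hM : ∀ i j : Fin n, i.val + 1 = j.val → ColoringsAgree (M i) (M j)) {i : Fin n}
    {e e' : (w i).Edge} {r : (M i).reducedSlice.Edge} (hs : (M i).Collapses e.src r.src)
    (ht : (M i).Collapses e.tgt r.tgt) (hs' : (M i).Collapses e'.src r.src)
    (ht' : (M i).Collapses e'.tgt r.tgt) : H.Parallel (part ⟨i, e⟩) (part ⟨i, e'⟩) := by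
  apply D.parallel_of_sameCell_of_agree hM
  rcases r.src_cases with ⟨p, hp⟩ | hp
  · rw [hp] at hs hs'
    obtain ⟨k, hk, hc⟩ := hs.of_inF
    obtain ⟨l, hl, hc'⟩ := hs'.of_inF
    exact Or.inl ⟨k, l, hk, hl, hc.trans hc'.symm⟩
  · obtain ⟨q, hq⟩ := exists_tgt_of_src_center hp
    rw [hq] at ht ht'
    obtain ⟨k, hk, hc⟩ := ht.of_outF
    obtain ⟨l, hl, hc'⟩ := ht'.of_outF
    exact Or.inr ⟨k, l, hk, hl, hc.trans hc'.symm⟩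

theorem eq_of_collapses (D : IsDecomposition w H c part)
    (hM : ∀ i j : Fin n, i.val + 1 = j.val → ColoringsAgree (M i) (M j)) {i : Fin n}
    {e e' : (w i).Edge} {r r' : (M i).reducedSlice.Edge} (hs : (M i).Collapses e.src r.src)
    (ht : (M i).Collapses e.tgt r.tgt) (hs' : (M i).Collapses e'.src r'.src)
    (ht' : (M i).Collapses e'.tgt r'.tgt) (h : H.Parallel (part ⟨i, e⟩) (part ⟨i, e'⟩)) :
    r = r' := by
  obtain ⟨hin, hout⟩ := D.sameCell_of_parallel hM h
  refine Subtype.ext (Prod.ext ?_ ?_)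
  · rcases e.src_cases with hk | hk
    · obtain ⟨k, l, hk, hl, hc⟩ := hin hk
      rw [hk] at hs
      rw [hl] at hs'
      exact hs.eq_of_inF hs' hc
    · have hk' : e'.src = .center := by rwa [D.src_eq_center_iff, ← h.1, ← D.src_eq_center_iff]
      rw [hk] at hs
      rw [hk'] at hs'
      exact hs.eq_center.trans hs'.eq_center.symm
  · rcases e.tgt_cases with hk | hk
    · have hk' : e'.tgt = .center := by rwa [D.tgt_eq_center_iff, ← h.2, ← D.tgt_eq_center_iff]
      rw [hk] at ht
      rw [hk'] at ht'
      exact ht.eq_center.trans ht'.eq_center.symm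
    · obtain ⟨k, l, hk, hl, hc⟩ := hout hk
      rw [hk] at ht
      rw [hl] at ht'
      exact ht.eq_of_outF ht' hc

theorem isSliceWord_reduced (hw : IsSliceWord w)
    (hM : ∀ i j : Fin n, i.val + 1 = j.val → ColoringsAgree (M i) (M j)) :
    IsSliceWord fun i => (M i).reducedSlice := by
  refine ⟨fun i hi => ?_, fun i hi => ?_, fun i j h =>
    congrArg Finset.card ((hM i j h).unmarked_eq (hw.2.2 i j h))⟩
  · have h0 : (w i).inn = 0 := hw.1 i hi
    show (M i).unmarkedIn.card = 0
    refine Finset.card_eq_zero.2 (Finset.eq_empty_of_forall_notMem fun k hk => ?_)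
    obtain ⟨p, -⟩ := (M i).exists_inF_eq hk
    obtain ⟨-, k, -⟩ := (M i).exists_in p
    exact absurd k.2 (by omega)
  · have h0 : (w i).out = 0 := hw.2.1 i hi
    show (M i).unmarkedOut.card = 0
    refine Finset.card_eq_zero.2 (Finset.eq_empty_of_forall_notMem fun k hk => ?_)
    obtain ⟨p, -⟩ := (M i).exists_outF_eq hk
    obtain ⟨-, k, -⟩ := (M i).exists_out p
    exact absurd k.2 (by omega)

/-- The slices reduced by coherent colorings decompose the transitive reduction of the DAG. -/
theorem isUnitDecomposition_reduct (D : IsDecomposition w H c part)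
    (hM : ∀ i j : Fin n, i.val + 1 = j.val → ColoringsAgree (M i) (M j)) :
    IsUnitDecomposition (fun i => (M i).reducedSlice) H.reduct c := by
  have hex : ∀ x : Σ i, (M i).reducedSlice.Edge, ∃ e : (w x.1).Edge,
      (M x.1).θ e e = some (false, false) ∧ (M x.1).Collapses e.src x.2.src ∧
        (M x.1).Collapses e.tgt x.2.tgt := fun x => x.2.2
  -- A representative unmarked edge for each reduced edge; another choice would be parallel, hence
  -- have the same endpoints in `H`.
  choose lift hmark hsrc htgt using hex
  have main : IsDecomposition (fun i => (M i).reducedSlice) H.reduct c (fun x =>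
      ⟨(H.src (part ⟨x.1, lift x⟩), H.tgt (part ⟨x.1, lift x⟩)), part ⟨x.1, lift x⟩,
        (D.unmarked_iff hM _).1 (hmark x), rfl, rfl⟩) := by
    refine ⟨isSliceWord_reduced D.word hM, fun i => D.label i, ?_, ?_, ?_, ?_, ?_⟩
    · rintro ⟨⟨a, b⟩, ε, hε, hs, ht⟩
      simp only at hs ht
      subst hs ht
      obtain ⟨⟨i, e⟩, rfl⟩ := D.surjective ε
      rw [← D.unmarked_iff hM] at hε
      obtain ⟨a, ha⟩ := collapses_src M hε
      obtain ⟨b, hb⟩ := collapses_tgt M hε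
      let r : (M i).reducedSlice.Edge := ⟨(a, b), e, hε, ha, hb⟩
      have hp := D.parallel_of_collapses hM (r := r) (hsrc ⟨i, r⟩) (htgt ⟨i, r⟩) ha hb
      exact ⟨⟨i, r⟩, Subtype.ext (Prod.ext hp.1 hp.2)⟩
    · rintro ⟨i, r⟩ ⟨j, r'⟩ ⟨hij, k, l, hk, hl, hkl⟩
      simp only at hij hk hl
      have h₁ := htgt ⟨i, r⟩
      have h₂ := hsrc ⟨j, r'⟩
      simp only [hk, hl] at h₁ h₂
      obtain ⟨k', hk', hc⟩ := h₁.of_outF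
      obtain ⟨l', hl', hc'⟩ := h₂.of_inF
      -- The continuation `f` of the lift of `r` need not be the lift of `r'`; they share an
      -- in-frontier cell, which suffices for parallelism.
      obtain ⟨⟨j', f⟩, hg⟩ := D.word.exists_next hk'
      obtain rfl : j' = j := Fin.ext (hg.1.symm.trans hij)
      have hu := (hM i j' hij).unmarked_eq (D.word.2.2 i j' hij)
      have hemb : (M i).unmarkedOut.orderEmbOfFin rfl k =
          (M j').unmarkedIn.orderEmbOfFin rfl l := by
        -- Abstracted over both sets, as the types of `k` and `l` depend on them.
        have key : ∀ (s t : Finset ℕ) (k : Fin s.card) (l : Fin t.card), s = t → k.val = l.val →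
            s.orderEmbOfFin rfl k = t.orderEmbOfFin rfl l := by
          rintro s _ k l rfl h
          rw [Fin.ext h]
        exact key (M i).unmarkedOut (M j').unmarkedIn k l hu hkl
      have hpar : H.Parallel (part ⟨j', f⟩) (part ⟨j', lift ⟨j', r'⟩⟩) := by
        apply D.parallel_of_sameCell_of_agree hM
        obtain ⟨-, k₁, l₁, hk₁, hl₁, h⟩ := hg
        simp only at hk₁ hl₁
        rw [hk'] at hk₁
        cases hk₁
        refine Or.inl ⟨l₁, l', hl₁, hl', ?_⟩
        rw [← (hM i j' hij).2 _ _ h, hc, hc', hemb]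
      rw [← D.glued hg] at hpar
      exact Subtype.ext (Prod.ext hpar.1 hpar.2)
    · intro i r r' h
      have h' := congrArg Subtype.val h
      exact D.eq_of_collapses hM (hsrc ⟨i, r⟩) (htgt ⟨i, r⟩) (hsrc ⟨i, r'⟩) (htgt ⟨i, r'⟩)
        ⟨congrArg Prod.fst h', congrArg Prod.snd h'⟩
    · intro x hx
      have h := hsrc x
      rw [hx] at h
      exact D.src_center (x := ⟨x.1, lift x⟩) h.of_center
    · intro x hx
      have h := htgt x
      rw [hx] at h
      exact D.tgt_center (x := ⟨x.1, lift x⟩) h.of_center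
  exact main.isUnitDecomposition

/-- Among the edges entering the center, one with the latest source is unmarked: a mark would need
an entering edge with a later source. -/
theorem exists_unmarked_in (D : IsDecomposition w H c part) {i : Fin n}
    (h : ∃ e : (w i).Edge, e.tgt = .center) :
    ∃ e : (w i).Edge, e.tgt = .center ∧ ¬ H.IsMarked (part ⟨i, e⟩) := by
  obtain ⟨e, he, hmax⟩ := Set.exists_max_image {e : (w i).Edge | e.tgt = .center}
    (fun e => c.symm (H.src (part ⟨i, e⟩))) (Set.toFinite _) h
  refine ⟨e, he, ?_⟩
  rintro ⟨ε, ht, hlt⟩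
  rw [D.tgt_center (x := ⟨i, e⟩) he] at ht
  obtain ⟨e', he', rfl⟩ := D.exists_tgt_part ε ht
  exact absurd (D.pos_lt hlt) (not_lt.2 (hmax e' he'))

/-- Among the edges leaving the center, one with the earliest target is unmarked: a mark would give
a longer path to that target, whose first edge leaves the center and ends earlier. -/
theorem exists_unmarked_out (D : IsDecomposition w H c part) {i : Fin n}
    (h : ∃ e : (w i).Edge, e.src = .center) :
    ∃ e : (w i).Edge, e.src = .center ∧ ¬ H.IsMarked (part ⟨i, e⟩) := by
  obtain ⟨e, he, hmin⟩ := Set.exists_min_image {e : (w i).Edge | e.src = .center}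
    (fun e => c.symm (H.tgt (part ⟨i, e⟩))) (Set.toFinite _) h
  refine ⟨e, he, ?_⟩
  rintro ⟨ε, ht, hlt⟩
  rw [D.src_center (x := ⟨i, e⟩) he] at hlt
  obtain ⟨δ, hδ, hle⟩ := DAG.lt_edge_iff'.1 hlt
  obtain ⟨e', he', rfl⟩ := D.exists_src_part δ hδ
  have h1 := hmin e' he'
  have h2 := D.pos_src_lt_tgt ε
  rw [ht] at h2
  have h3 : c.symm (H.tgt (part ⟨i, e'⟩)) ≤ c.symm (H.src ε) := by
    rcases hle with h | h
    · rw [h]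
    · exact (D.pos_lt h).le
  exact absurd (h1.trans h3) (not_le.2 h2)

end IsDecomposition

/-! ### Walks of slice graphs and useful vertices -/

theorem Relation.ReflTransGen.exists_walk {α : Type*} {r : α → α → Prop} {a b : α}
    (h : Relation.ReflTransGen r a b) :
    ∃ (m : ℕ) (f : ℕ → α), f 0 = a ∧ f m = b ∧ ∀ i < m, r (f i) (f (i + 1)) := by
  induction h with
  | refl => exact ⟨0, fun _ => a, rfl, rfl, by simp⟩
  | @tail b d _ h ih =>
    obtain ⟨m, f, h0, hm, hf⟩ := ih
    refine ⟨m + 1, fun i => if i ≤ m then f i else d, by simpa using h0, by simp, fun i hi => ?_⟩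
    rcases Nat.lt_succ_iff_lt_or_eq.1 hi with hi | rfl
    · simpa [hi.le, Nat.succ_le_of_lt hi] using hf i hi
    · simpa [hm] using h

namespace SliceGraph

variable {T : Type u}

theorem ofFn_mem_language {G : SliceGraph.{u, v} T} {n : ℕ} {w : Fin n → UnitSlice T} :
    List.ofFn w ∈ G.language ↔ n ≠ 0 ∧ ∃ a : Fin n → G.V,
      (∀ i j : Fin n, i.val + 1 = j.val → G.E (a i) (a j)) ∧
      (∀ i : Fin n, i.val = 0 → (G.slice (a i)).IsInitial) ∧
      (∀ i : Fin n, i.val + 1 = n → (G.slice (a i)).IsFinal) ∧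
      w = fun i => G.slice (a i) := by
  constructor
  · rintro ⟨m, a, hE, h0, hl, hw⟩
    obtain rfl : n = m + 1 := by simpa using congrArg List.length hw
    refine ⟨Nat.succ_ne_zero m, a, fun i j hij => ?_, fun i hi => ?_, fun i hi => ?_,
      List.ofFn_injective hw⟩
    · have hi : i.val < m := by have := j.2; omega
      have h := hE ⟨i.val, hi⟩
      rwa [show (⟨i.val, hi⟩ : Fin m).castSucc = i from rfl,
        show (⟨i.val, hi⟩ : Fin m).succ = j from Fin.ext hij] at h
    · obtain rfl : i = 0 := Fin.ext hi
      exact h0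
    · obtain rfl : i = Fin.last m := Fin.ext (Nat.add_right_cancel hi)
      exact hl
  · rintro ⟨hn, a, hE, h0, hl, rfl⟩
    obtain ⟨m, rfl⟩ := Nat.exists_eq_succ_of_ne_zero hn
    exact ⟨m, a, fun i => hE _ _ rfl, h0 _ rfl, hl _ rfl, rfl⟩

theorem isSliceWord_of_walk (G : SliceGraph.{u, v} T) {n : ℕ} {a : Fin n → G.V}
    (hE : ∀ i j : Fin n, i.val + 1 = j.val → G.E (a i) (a j))
    (h0 : ∀ i : Fin n, i.val = 0 → (G.slice (a i)).IsInitial)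
    (hl : ∀ i : Fin n, i.val + 1 = n → (G.slice (a i)).IsFinal) :
    IsSliceWord fun i => G.slice (a i) :=
  ⟨h0, hl, fun i j hij => G.composable _ _ (hE i j hij)⟩

/-- A useful vertex lies on a walk of the expansion from an initial to a final vertex. -/
theorem IsUseful.exists_walk {G : SliceGraph.{u, v} T} {x : G.ExpandedVertex} (h : G.IsUseful x) :
    ∃ (n : ℕ) (a : Fin n → G.ExpandedVertex),
      (∀ i j : Fin n, i.val + 1 = j.val → G.ExpandedEdge (a i) (a j)) ∧
      (∀ i : Fin n, i.val = 0 → (G.slice (a i).1).IsInitial) ∧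
      (∀ i : Fin n, i.val + 1 = n → (G.slice (a i).1).IsFinal) ∧ ∃ i, a i = x := by
  obtain ⟨⟨y, hy, hyx⟩, z, hz, hxz⟩ := h
  obtain ⟨k, f, hf0, hfk, hf⟩ := hyx.exists_walk
  obtain ⟨l, g, hg0, hgl, hg⟩ := hxz.exists_walk
  have hpre : ∀ i ≤ k, (fun i => if i ≤ k then f i else g (i - k)) i = f i :=
    fun i hi => if_pos hi
  have hsuf : ∀ i, k ≤ i → (fun i => if i ≤ k then f i else g (i - k)) i = g (i - k) := by
    intro i hi
    rcases hi.eq_or_lt with rfl | hi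
    · simp [hfk, hg0]
    · exact if_neg (not_le.2 hi)
  generalize (fun i => if i ≤ k then f i else g (i - k)) = a at hpre hsuf
  refine ⟨k + l + 1, fun i => a i.val, fun i j hij => ?_, fun i hi => ?_, fun i hi => ?_,
    ⟨k, by omega⟩, ?_⟩
  · show G.ExpandedEdge (a i.val) (a j.val)
    rw [← hij]
    by_cases hi : i.val < k
    · rw [hpre _ hi.le, hpre _ hi]
      exact hf _ hi
    · rw [hsuf _ (by omega), hsuf _ (by omega), show i.val + 1 - k = i.val - k + 1 by omega]
      exact hg _ (by have := j.2; omega)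
  · show (G.slice (a i.val).1).IsInitial
    rw [hi, hpre _ (Nat.zero_le k), hf0]
    exact hy
  · show (G.slice (a i.val).1).IsFinal
    rw [hsuf _ (by omega), show i.val - k = l by omega, hgl]
    exact hz
  · show a k = x
    rw [hpre k le_rfl, hfk]

/-- In a useful vertex, an edge touching the center on the left yields an unmarked such edge, and
the same on the right. -/
theorem IsUseful.exists_unmarked {G : SliceGraph.{u, v} T} {x : G.ExpandedVertex}
    (h : G.IsUseful x) :
    ((∃ e : (G.slice x.1).Edge, e.tgt = .center) →
      ∃ e : (G.slice x.1).Edge, e.tgt = .center ∧ x.2.θ e e = some (false, false)) ∧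
    ((∃ e : (G.slice x.1).Edge, e.src = .center) →
      ∃ e : (G.slice x.1).Edge, e.src = .center ∧ x.2.θ e e = some (false, false)) := by
  obtain ⟨n, a, hE, h0, hl, i, rfl⟩ := h.exists_walk
  -- The marks at one vertex gain a meaning only inside a whole word, which usefulness provides.
  obtain ⟨H, c, part, D⟩ := (G.isSliceWord_of_walk (a := fun i => (a i).1)
    (fun i j hij => (hE i j hij).1) h0 hl).exists_composition
  have hM : ∀ i j : Fin n, i.val + 1 = j.val → ColoringsAgree (a i).2 (a j).2 :=
    fun i j hij => (hE i j hij).2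
  constructor
  · intro he
    obtain ⟨e, he, hm⟩ := D.exists_unmarked_in he
    exact ⟨e, he, (D.unmarked_iff (M := fun i => (a i).2) hM e).2 hm⟩
  · intro he
    obtain ⟨e, he, hm⟩ := D.exists_unmarked_out he
    exact ⟨e, he, (D.unmarked_iff (M := fun i => (a i).2) hM e).2 hm⟩

/-- Excludes false starts. If the in-frontier is non-empty, non-degeneracy joins it to the center,
and an unmarked edge into the center survives the reduction. -/
theorem IsUseful.isInitial {G : SliceGraph.{u, v} T} {x : G.ExpandedVertex} (h : G.IsUseful x)
    (hx : (G.slice x.1).Nondegenerate) (h0 : x.2.reducedSlice.IsInitial) :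
    (G.slice x.1).IsInitial := by
  by_contra hne
  obtain ⟨k, hk⟩ := hx.1 hne
  obtain ⟨e, he, hm⟩ := h.exists_unmarked.1 ⟨⟨(_, _), hk⟩, rfl⟩
  obtain ⟨l, hl⟩ := IsDecomposition.exists_src_of_tgt_center he
  exact Finset.card_ne_zero_of_mem (x.2.mem_unmarkedIn hl hm) h0

theorem IsUseful.isFinal {G : SliceGraph.{u, v} T} {x : G.ExpandedVertex} (h : G.IsUseful x)
    (hx : (G.slice x.1).Nondegenerate) (h0 : x.2.reducedSlice.IsFinal) :
    (G.slice x.1).IsFinal := by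
  by_contra hne
  obtain ⟨k, hk⟩ := hx.2 hne
  obtain ⟨e, he, hm⟩ := h.exists_unmarked.2 ⟨⟨(_, _), hk⟩, rfl⟩
  obtain ⟨l, hl⟩ := IsDecomposition.exists_tgt_of_src_center he
  exact Finset.card_ne_zero_of_mem (x.2.mem_unmarkedOut hl hm) h0

/-- All vertices of a walk of the expansion from an initial to a final vertex are useful. -/
theorem isUseful_of_walk {G : SliceGraph.{u, v} T} {n : ℕ} {a : Fin n → G.ExpandedVertex}
    (hE : ∀ i j : Fin n, i.val + 1 = j.val → G.ExpandedEdge (a i) (a j))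
    (h0 : ∀ i : Fin n, i.val = 0 → (G.slice (a i).1).IsInitial)
    (hl : ∀ i : Fin n, i.val + 1 = n → (G.slice (a i).1).IsFinal) (i : Fin n) :
    G.IsUseful (a i) := by
  have reach : ∀ (d : ℕ) (i j : Fin n), i.val + d = j.val →
      Relation.ReflTransGen G.ExpandedEdge (a i) (a j) := by
    intro d
    induction d with
    | zero =>
      intro i j h
      obtain rfl : i = j := Fin.ext h
      exact .refl
    | succ d ih =>
      intro i j h
      exact (ih i ⟨i.val + d, by omega⟩ rfl).tail (hE _ j h)
  have hi := i.2
  exact ⟨⟨a ⟨0, by omega⟩, h0 _ rfl, reach i.val _ i (Nat.zero_add _)⟩,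
    ⟨a ⟨n - 1, by omega⟩, hl _ (by simp only; omega),
      reach (n - 1 - i.val) i _ (by simp only; omega)⟩⟩

end SliceGraph

/-! ### Weak saturation of the transitive reduction -/

theorem proposition1 {T : Type u} (c : ℕ) (G : SliceGraph.{u, v} T)
    (hG : G.Over (sliceAlphabet T c)) (hsat : G.IsWeaklySaturated) :
    G.transitiveReduction.IsWeaklySaturated := by
  rintro K ⟨n, w, d, hw, hdec⟩ m o ho
  obtain ⟨-, a, hE, h0, hl, rfl⟩ := SliceGraph.ofFn_mem_language.1 hw
  have hn : n ≠ 0 := (SliceGraph.ofFn_mem_language.1 hw).1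
  have hE₁ : ∀ i j : Fin n, i.val + 1 = j.val → G.E (a i).1.1 (a j).1.1 :=
    fun i j hij => (hE i j hij).1
  have h0₁ : ∀ i : Fin n, i.val = 0 → (G.slice (a i).1.1).IsInitial :=
    fun i hi => (a i).2.isInitial (hG _).1 (h0 i hi)
  have hl₁ : ∀ i : Fin n, i.val + 1 = n → (G.slice (a i).1.1).IsFinal :=
    fun i hi => (a i).2.isFinal (hG _).1 (hl i hi)
  -- The unreduced word behind the given word of the reduced graph; `K` is isomorphic to the
  -- reduction of its composition `H`.
  obtain ⟨H, c, part, D⟩ := (G.isSliceWord_of_walk hE₁ h0₁ hl₁).exists_composition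
  have hH : H ∈ graphLanguage G.language :=
    ⟨n, _, c, SliceGraph.ofFn_mem_language.2 ⟨hn, _, hE₁, h0₁, hl₁, rfl⟩, D.isUnitDecomposition⟩
  have hred := D.isUnitDecomposition_reduct (M := fun i => (a i).1.2)
    fun i j hij => (hE i j hij).2
  obtain ⟨φ, hφ⟩ := hred.exists_edgeEquiv hdec
  have hlt : ∀ {x y}, H.Lt x y → K.Lt (d (c.symm x)) (d (c.symm y)) := by
    intro x y h
    refine Relation.TransGen.lift (fun x => d (c.symm x)) ?_ _ _ (D.reduct_lt h)
    rintro _ _ ⟨ε, rfl, rfl⟩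
    exact ⟨φ ε, (hφ ε).1, (hφ ε).2⟩
  -- Every relation of `H` holds in `K`, so an ordering respecting `K` respects `H`.
  have hord : H.IsTopologicalOrdering (o.trans (d.symm.trans c)) := by
    intro i j h
    exact ho i j (by simpa using hlt h)
  obtain ⟨w, hw, hdec'⟩ := hsat H hH m _ hord
  obtain ⟨part', D'⟩ := hdec'.exists_part
  obtain ⟨hm, b, hE₂, h0₂, hl₂, rfl⟩ := SliceGraph.ofFn_mem_language.1 hw
  -- The new decomposition of `H` is lifted to the expansion by the coloring that `H` itself
  -- induces.
  let x : Fin m → G.ExpandedVertex := fun i => ⟨b i, D'.multiEdgeColoring i⟩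
  have hM : ∀ i j : Fin m, i.val + 1 = j.val →
      ColoringsAgree (D'.multiEdgeColoring i) (D'.multiEdgeColoring j) :=
    fun i j hij => D'.coloringsAgree hij
  have hxE : ∀ i j : Fin m, i.val + 1 = j.val → G.ExpandedEdge (x i) (x j) :=
    fun i j hij => ⟨hE₂ i j hij, hM i j hij⟩
  have hred' := D'.isUnitDecomposition_reduct hM
  refine ⟨fun i => (D'.multiEdgeColoring i).reducedSlice, SliceGraph.ofFn_mem_language.2
    ⟨hm, fun i => ⟨x i, SliceGraph.isUseful_of_walk hxE h0₂ hl₂ i⟩, hxE, hred'.1.1, hred'.1.2.1,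
      rfl⟩, ?_⟩
  -- Both reduced words decompose the same DAG `H.reduct`, so the isomorphism found from the first
  -- word carries the second to `K`.
  have hres := hred'.congr (c.symm.trans d) φ hφ fun v => ?_
  · convert hres using 1
    ext i
    simp
  · obtain ⟨i, rfl⟩ := c.surjective v
    rw [Equiv.trans_apply, c.symm_apply_apply, hdec.2.1, hred.2.1]
    rfl
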